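/- A \emph{4-collision} of a function $f : X \to Y$ is a set of four distinct elements of $X$ on which $f$ is constant. Let $Y$ be a finite commutative group with $|Y| = N$ and let $X$ be a finite set. A quantum algorithm making $q$ queries to $f : X \to Y$ has a query register $X$, a response register $Y$ and a private register over an arbitrary finite set $Z$; it starts in a fixed unit vector, applies $q$ times the query unitary $|x,u,z\rangle \mapsto |x, u + f(x), z\rangle$, each time followed by an arbitrary unitary that does not depend on $f$, and finally measures all registers in the computational basis and computes its output from the outcome. For every $p > 0$ there are a constant $c > 0$ and an integer $N_0$, depending only on $p$, such that the following holds for all integers $N \ge N_0$ and $j \ge 0$ with $j \le N^{1/16}$, and for all $X$, $Y$, $Z$ as above: every quantum algorithm which, given oracle access to a uniformly random function $f : X \to Y$, outputs with probability at least $p$ (over $f$ and the measurement) a collection of $j$ distinct, pairwise disjoint $4$-collisions of $f$, makes at least $c\, j^{8/15} N^{7/15}$ queries. In other words, finding $j$ distinct $4$-collisions with constant probability needs $\Omega(j^{8/15} N^{7/15})$ quantum queries. -/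

import Mathlib

/-- The adversary's state space: the query register `X`, the response register `Y` and a private
register `Z`, with computational basis `|x, u, z⟩`. -/
abbrev RegisterSpace (X Y Z : Type*) : Type _ := EuclideanSpace ℂ (X × Y × Z)

/-- The permutation `(x, u, z) ↦ (x, u + f x, z)` of the computational basis. -/
def queryPerm {X Y : Type*} (Z : Type*) [AddCommGroup Y] (f : X → Y) :
    X × Y × Z ≃ X × Y × Z where
  toFun b := (b.1, b.2.1 + f b.1, b.2.2)
  invFun b := (b.1, b.2.1 - f b.1, b.2.2)
  left_inv b := by simp
  right_inv b := by simp

/-- One quantum query to `f`: the unitary `|x, u, z⟩ ↦ |x, u + f x, z⟩`. -/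
noncomputable def queryOracle {X Y : Type*} (Z : Type*) [Fintype X] [Fintype Y] [Fintype Z]
    [AddCommGroup Y] (f : X → Y) : RegisterSpace X Y Z ≃ₗᵢ[ℂ] RegisterSpace X Y Z :=
  LinearIsometryEquiv.piLpCongrLeft 2 ℂ ℂ (queryPerm Z f)

theorem queryOracle_single {X Y Z : Type*} [Fintype X] [Fintype Y] [Fintype Z]
    [DecidableEq X] [DecidableEq Y] [DecidableEq Z] [AddCommGroup Y] (f : X → Y)
    (x : X) (u : Y) (z : Z) :
    queryOracle Z f (EuclideanSpace.single (x, u, z) (1 : ℂ)) =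
      EuclideanSpace.single (x, u + f x, z) (1 : ℂ) :=
  LinearIsometryEquiv.piLpCongrLeft_single (queryPerm Z f) (x, u, z) (1 : ℂ)

/-- A quantum query algorithm with oracle access to a function `X → Y` and outputs in `O`.
It starts in the unit vector `init` and makes exactly `queries` queries; the `i`-th query
(counted from `0`) is followed by the arbitrary unitary `step i`, which does not depend on the
oracle. At the end all registers are measured in the computational basis, and the output is
computed from the outcome. (Only `step i` with `i < queries` is ever applied.) -/
structure QuantumQueryAlgorithm (X Y Z O : Type*) [Fintype X] [Fintype Y] [Fintype Z] where
  init : RegisterSpace X Y Z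
  norm_init : ‖init‖ = 1
  queries : ℕ
  step : ℕ → (RegisterSpace X Y Z ≃ₗᵢ[ℂ] RegisterSpace X Y Z)
  output : X × Y × Z → O

namespace QuantumQueryAlgorithm

variable {X Y Z O : Type*} [Fintype X] [Fintype Y] [Fintype Z] [AddCommGroup Y]

/-- The state after `i` queries to `f`, each followed by its unitary. -/
noncomputable def stateAfter (A : QuantumQueryAlgorithm X Y Z O) (f : X → Y) :
    ℕ → RegisterSpace X Y Z
  | 0 => A.init
  | i + 1 => A.step i (queryOracle Z f (A.stateAfter f i))

open Classical in
/-- The probability that the output of the algorithm, run with oracle `f`, satisfies `W`. -/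
noncomputable def probOutput (A : QuantumQueryAlgorithm X Y Z O) (f : X → Y) (W : O → Prop) : ℝ :=
  ∑ b : X × Y × Z, if W (A.output b) then ‖A.stateAfter f A.queries b‖ ^ 2 else 0

/-- The probability, over a uniformly random function `f : X → Y` and the final measurement,
that the output of the algorithm run with oracle `f` satisfies `W f`. -/
noncomputable def successProb [DecidableEq X] (A : QuantumQueryAlgorithm X Y Z O)
    (W : (X → Y) → O → Prop) : ℝ :=
  (∑ f : X → Y, A.probOutput f (W f)) / (Fintype.card (X → Y) : ℝ)

end QuantumQueryAlgorithm

/-- A `k`-collision of `f`: a set of `k` distinct inputs that all have the same image. -/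
def IsMultiCollision {X Y : Type*} (k : ℕ) (f : X → Y) (S : Finset X) : Prop :=
  S.card = k ∧ ∀ x ∈ S, ∀ x' ∈ S, f x = f x'

/-- `C` consists of `j` distinct `k`-collisions of `f`, no two of which share an input.
Two of them may have the same image. -/
def IsCollisionFamily {X Y : Type*} (k j : ℕ) (f : X → Y) (C : Finset (Finset X)) : Prop :=
  C.card = j ∧ (∀ S ∈ C, IsMultiCollision k f S) ∧
    ∀ S ∈ C, ∀ S' ∈ C, S ≠ S' → Disjoint S S'

/-! This is Zhandry's compressed-oracle method, carried out on functions of `f`. An oracle-dependent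
state `ψ` splits orthogonally over the sets `S` of recorded inputs: `component S univ ψ` is averaged
over the values outside `S` and has mean zero at each input in `S`. The initial state does not
depend on `f`, so only `S = ∅` occurs. `collAmplitude` is the norm of the part where `f` has at
least `j` disjoint `k`-collisions inside `S`.

Oracle-independent unitaries preserve this norm. A query at `x` can only change whether `x` is
recorded. To complete a new `(k+1)`-collision, `f x` must hit a value already recorded `k` times.
There are at most `M` such values unless more than `M` `k`-collisions are recorded, and a function
independent of `f x` keeps only a fraction `M / N` of its squared norm on them. Hence
`collAmplitude_succ_le`: with `P k j i` the amplitude after `i` queries, `P (k+1) (j+1) (i+1) ≤ P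
(k+1) (j+1) i + 2√(M/N) P (k+1) j i + P k (M+1) i`.

By `le_of_add_recurrence`, the amplitude is tiny once `j` exceeds a multiple of `L = 2q√(M/N)`, up
to the error from level `k`. Starting from `M = q` at `k = 1`, the scales for 2-, 3- and
4-collisions are `q^(3/2)/N^(1/2)`, `q^(7/4)/N^(3/4)` and `q^(15/8)/N^(7/8)`. The last is a small
multiple of `j` when `q` is a small multiple of `j^(8/15) N^(7/15)`.

Finally, a correct output must essentially be recorded: guessing unrecorded values costs at most
`4j/√N` in amplitude (`sqrt_successProb_le`). -/

open Finset Function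

set_option linter.unusedSectionVars false

/-- The average of `g` over the value of its argument at `x`. -/
noncomputable def avgAt {X Y M : Type*} [DecidableEq X] [Fintype Y] [AddCommGroup M] [Module ℂ M]
    (x : X) (g : (X → Y) → M) (f : X → Y) : M :=
  (Fintype.card Y : ℂ)⁻¹ • ∑ y, g (update f x y)

/-- The kernel at the input `x` of the operator `component S R`. -/
noncomputable def componentKernel {X Y : Type*} [DecidableEq X] [Fintype Y] [DecidableEq Y]
    (S R : Finset X) (x : X) (y y' : Y) : ℂ :=
  if x ∈ S then (if y = y' then 1 else 0) - (Fintype.card Y : ℂ)⁻¹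
  else if x ∈ R then (Fintype.card Y : ℂ)⁻¹ else if y = y' then 1 else 0

/-- For `S ⊆ R`, the function obtained from `g` by averaging over the inputs in `R \ S` and
subtracting the average at every input in `S`. -/
noncomputable def component {X Y M : Type*} [Fintype X] [DecidableEq X] [Fintype Y] [DecidableEq Y]
    [AddCommGroup M] [Module ℂ M] (S R : Finset X) (g : (X → Y) → M) (f : X → Y) : M :=
  ∑ f', (∏ x, componentKernel S R x (f x) (f' x)) • g f'

/-! ### Averaging over the value at one input -/

section Fiber

variable {X Y : Type*} [Fintype X] [DecidableEq X] [Fintype Y]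

theorem sum_sum_update {A : Type*} [AddCommMonoid A] (x : X) (h : (X → Y) → A) :
    ∑ f, ∑ y, h (update f x y) = Fintype.card Y • ∑ f, h f := by
  have e : ∑ p : (X → Y) × Y, h (update p.1 x p.2) = ∑ p : (X → Y) × Y, h p.1 := by
    refine Finset.sum_bij' (fun p _ => (update p.1 x p.2, p.1 x))
      (fun p _ => (update p.1 x p.2, p.1 x)) ?_ ?_ ?_ ?_ ?_ <;> simp
  rw [← Fintype.sum_prod_type' (f := fun f y => h (update f x y)), e, Fintype.sum_prod_type]
  simp [Finset.smul_sum]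

theorem sum_eq_zero_of_sum_update [Nonempty Y] (x : X) (h : (X → Y) → ℝ)
    (h0 : ∀ f, ∑ y, h (update f x y) = 0) : ∑ f, h f = 0 := by
  have := sum_sum_update x h
  simpa [h0] using this

theorem avgAt_update {X Y M : Type*} [DecidableEq X] [Fintype Y] [AddCommGroup M] [Module ℂ M] (x : X) (g : (X → Y) → M) (f : X → Y) (y : Y) :
    avgAt x g (update f x y) = avgAt x g f := by
  simp [avgAt]

/-- A weight that does not depend on the value at `x`, restricted to an event which contains at
most `M` of the values at `x`, loses a factor `M / |Y|`. -/
theorem card_mul_sum_mul_le (x : X) (w b : (X → Y) → ℝ) (M : ℝ)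
    (hw : ∀ f y, w (update f x y) = w f) (hw0 : ∀ f, 0 ≤ w f)
    (hb : ∀ f, 0 < w f → ∑ y, b (update f x y) ≤ M) :
    Fintype.card Y * ∑ f, b f * w f ≤ M * ∑ f, w f := by
  have := sum_sum_update x (fun f => b f * w f)
  rw [nsmul_eq_mul] at this
  rw [← this, Finset.mul_sum]
  refine Finset.sum_le_sum fun f _ => ?_
  simp_rw [hw]
  rw [← Finset.sum_mul]
  rcases (hw0 f).eq_or_lt with h | h
  · simp [← h]
  · exact mul_le_mul_of_nonneg_right (hb f h) h.le

/-- Pythagoras on each fibre over the value at `x`: the deviation from the average sums to zero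
there, and the weight `d` is constant along the fibre. -/
theorem sum_sq_avgAt_add [Nonempty Y] (x : X) (d : (X → Y) → ℝ) (hd : ∀ f y, d (update f x y) = d f)
    (g : (X → Y) → ℂ) :
    ∑ f, d f * (‖avgAt x g f‖ ^ 2 + ‖g f - avgAt x g f‖ ^ 2) = ∑ f, d f * ‖g f‖ ^ 2 := by
  rw [← sub_eq_zero, ← Finset.sum_sub_distrib]
  refine sum_eq_zero_of_sum_update x _ fun f => ?_
  simp_rw [hd, avgAt_update]
  simp_rw [← mul_sub]
  rw [← Finset.mul_sum]
  refine mul_eq_zero_of_right _ ?_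
  set e := avgAt x g f with he
  have h1 : ∑ y, (g (update f x y) - e) = 0 := by
    rw [Finset.sum_sub_distrib, he, avgAt]
    simp
  have h2 : ∀ y, ‖e‖ ^ 2 + ‖g (update f x y) - e‖ ^ 2 - ‖g (update f x y)‖ ^ 2 =
      -2 * ((starRingEnd ℂ e) * (g (update f x y) - e)).re := by
    intro y
    simp only [← Complex.normSq_eq_norm_sq, Complex.normSq_apply, Complex.mul_re,
      Complex.conj_re, Complex.conj_im, Complex.sub_re, Complex.sub_im]
    ring
  simp_rw [h2]
  rw [← Finset.mul_sum, ← Complex.re_sum, ← Finset.mul_sum, h1]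
  simp

end Fiber

/-! ### Orthogonal decomposition by recorded inputs -/

section Component

variable {X Y M : Type*} [Fintype X] [DecidableEq X] [Fintype Y] [DecidableEq Y]
  [AddCommGroup M] [Module ℂ M]

theorem component_empty_empty (g : (X → Y) → M) : component ∅ ∅ g = g := by
  funext f
  unfold component
  rw [Finset.sum_eq_single f]
  · simp [componentKernel]
  · intro f' _ hf'
    obtain ⟨x, hx⟩ := Function.ne_iff.mp hf'
    rw [Finset.prod_eq_zero (Finset.mem_univ x), zero_smul]
    simp [componentKernel, Ne.symm hx]
  · simp

theorem avgAt_component (x : X) {S R : Finset X} (hS : x ∉ S) (hR : x ∉ R)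
    (g : (X → Y) → M) : avgAt x (component S R g) = component S (insert x R) g := by
  funext f
  unfold avgAt component
  rw [Finset.sum_comm, Finset.smul_sum]
  refine Finset.sum_congr rfl fun f' _ => ?_
  rw [← Finset.sum_smul, smul_smul]
  congr 1
  have h1 : ∀ y, ∏ x', componentKernel S R x' (update f x y x') (f' x') =
      (∏ x' ∈ univ.erase x, componentKernel S (insert x R) x' (f x') (f' x')) *
        (if y = f' x then 1 else 0) := by
    intro y
    rw [← Finset.prod_erase_mul _ _ (Finset.mem_univ x)]
    congr 1
    · refine Finset.prod_congr rfl fun x' hx' => ?_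
      have hne := Finset.ne_of_mem_erase hx'
      simp [componentKernel, hne]
    · simp [componentKernel, hS, hR]
  simp_rw [h1]
  rw [← Finset.mul_sum, ← Finset.prod_erase_mul _ _ (Finset.mem_univ x), mul_comm]
  simp [componentKernel, hS]

theorem component_insert_insert (x : X) {S R : Finset X} (hS : x ∉ S) (hR : x ∉ R)
    (g : (X → Y) → M) (f : X → Y) : component (insert x S) (insert x R) g f =
      component S R g f - component S (insert x R) g f := by
  unfold component
  rw [← Finset.sum_sub_distrib]
  refine Finset.sum_congr rfl fun f' _ => ?_
  rw [← sub_smul]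
  congr 1
  simp only [← Finset.prod_erase_mul _ _ (Finset.mem_univ x)]
  have h1 : ∏ x' ∈ univ.erase x, componentKernel (insert x S) (insert x R) x' (f x') (f' x') =
      ∏ x' ∈ univ.erase x, componentKernel S R x' (f x') (f' x') := by
    refine Finset.prod_congr rfl fun x' hx' => ?_
    have hne := Finset.ne_of_mem_erase hx'
    simp [componentKernel, hne]
  have h2 : ∏ x' ∈ univ.erase x, componentKernel S (insert x R) x' (f x') (f' x') =
      ∏ x' ∈ univ.erase x, componentKernel S R x' (f x') (f' x') := by
    refine Finset.prod_congr rfl fun x' hx' => ?_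
    have hne := Finset.ne_of_mem_erase hx'
    simp [componentKernel, hne]
  rw [h1, h2, ← mul_sub]
  simp [componentKernel, hS, hR]

/-- The kernel at an input outside `R` is the identity, so a dependence on `f x` passes through the
operator as a parameter. -/
theorem component_apply_self (x : X) {S R : Finset X} (hS : x ∉ S) (hR : x ∉ R)
    (g : Y → (X → Y) → M) (f : X → Y) :
    component S R (fun f' => g (f' x) f') f = component S R (g (f x)) f := by
  unfold component
  refine Finset.sum_congr rfl fun f' _ => ?_
  by_cases h : f x = f' x
  · rw [h]
  · rw [Finset.prod_eq_zero (Finset.mem_univ x), zero_smul, zero_smul]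
    simp [componentKernel, hS, hR, h]

theorem map_component {M' : Type*} [AddCommGroup M'] [Module ℂ M'] (L : M →ₗ[ℂ] M')
    (S R : Finset X) (g : (X → Y) → M) (f : X → Y) :
    L (component S R g f) = component S R (fun f' => L (g f')) f := by
  simp [component, map_sum]

/-- The kernel at a recorded input sums to zero, so an oracle-independent state has no recorded
inputs. -/
theorem component_const (S : Finset X) (hS : S.Nonempty) [Nonempty Y] (v : M) (f : X → Y) :
    component S univ (fun _ => v) f = 0 := by
  unfold component
  obtain ⟨x, hx⟩ := hS
  rw [← Finset.sum_smul, ← Fintype.piFinset_univ,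
    ← Finset.prod_univ_sum (fun _ => (univ : Finset Y))
      (fun x y' => componentKernel S univ x (f x) y'),
    Finset.prod_eq_zero (Finset.mem_univ x), zero_smul]
  simp [componentKernel, hx, Finset.sum_sub_distrib]

/-- The components indexed by `W ∪ S`, for `S ⊆ T`, are orthogonal, also on an event that does not
depend on the values on `T`. -/
theorem sum_sum_sq_component [Nonempty Y] (W T : Finset X) (hT : Disjoint W T) (d : (X → Y) → ℝ)
    (hd : ∀ x ∈ T, ∀ f y, d (update f x y) = d f) (g : (X → Y) → ℂ) :
    ∑ S ∈ T.powerset, ∑ f, d f * ‖component (W ∪ S) (W ∪ T) g f‖ ^ 2 =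
      ∑ f, d f * ‖component W W g f‖ ^ 2 := by
  induction T using Finset.induction_on with
  | empty => simp
  | insert x T hx ih =>
    rw [Finset.disjoint_insert_right] at hT
    rw [Finset.sum_powerset_insert hx, ← ih hT.2 fun x' hx' => hd x' (by simp [hx']),
      ← Finset.sum_add_distrib]
    refine Finset.sum_congr rfl fun S hS => ?_
    have hSx : x ∉ S := fun h => hx (Finset.mem_powerset.mp hS h)
    have h1 : x ∉ W ∪ S := by simp [hT.1, hSx]
    have h2 : x ∉ W ∪ T := by simp [hT.1, hx]
    rw [← sum_sq_avgAt_add x d (hd x (by simp)) (component (W ∪ S) (W ∪ T) g),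
      ← Finset.sum_add_distrib]
    refine Finset.sum_congr rfl fun f _ => ?_
    rw [avgAt_component x h1 h2, Finset.union_insert, Finset.union_insert,
      component_insert_insert x h1 h2, mul_add]

end Component

theorem sum_finset_eq_sum_powerset_erase {X A : Type*} [Fintype X] [DecidableEq X] [AddCommMonoid A] (x : X)
    (F : Finset X → A) :
    ∑ S, F S = ∑ S ∈ (univ.erase x).powerset, (F S + F (insert x S)) := by
  rw [Finset.sum_add_distrib, ← Finset.sum_powerset_insert (by simp),
    Finset.insert_erase (Finset.mem_univ x), Finset.powerset_univ]

/-! ### One query, with the query register and the other recorded inputs fixed -/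

section Block

variable {X Y : Type*} [Fintype X] [DecidableEq X] [Fintype Y] [AddCommGroup Y]

/-- For fixed `f` the query only permutes the response register. Pythagoras at `x` on both sides
reduces the claim to this. -/
theorem sum_sum_sq_query (x : X) (d : (X → Y) → ℝ) (hd : ∀ f y, d (update f x y) = d f)
    (φ : Y → (X → Y) → ℂ) :
    ∑ u, ∑ f, d f * (‖avgAt x (fun f' => φ (u - f' x) f') f‖ ^ 2 +
        ‖φ (u - f x) f - avgAt x (fun f' => φ (u - f' x) f') f‖ ^ 2) =
      ∑ u, ∑ f, d f * (‖avgAt x (φ u) f‖ ^ 2 + ‖φ u f - avgAt x (φ u) f‖ ^ 2) := by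
  have h1 : ∀ u : Y, _ := fun u => sum_sq_avgAt_add x d hd (fun f' => φ (u - f' x) f')
  have h2 : ∀ u : Y, _ := fun u => sum_sq_avgAt_add x d hd (φ u)
  simp_rw [h1, h2]
  refine Finset.sum_comm.trans (Eq.trans ?_ Finset.sum_comm)
  refine Finset.sum_congr rfl fun f _ => ?_
  exact Equiv.sum_comp (Equiv.subRight (f x)) (fun u => d f * ‖φ u f‖ ^ 2)

/-- The triangle inequality in a quadratic form that can be summed term by term; optimising `δ`
after summation recovers it for the total norms. -/
theorem norm_add_sq_le_mul {E : Type*} [SeminormedAddCommGroup E] {δ : ℝ} (hδ : 0 < δ) (v w : E) :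
    ‖v + w‖ ^ 2 ≤ (1 + δ) * ‖v‖ ^ 2 + (1 + 1 / δ) * ‖w‖ ^ 2 := by
  have h1 : ‖v + w‖ ^ 2 ≤ (‖v‖ + ‖w‖) ^ 2 := by
    gcongr
    exact norm_add_le v w
  have h2 : (1 + δ) * ‖v‖ ^ 2 + (1 + 1 / δ) * ‖w‖ ^ 2 - (‖v‖ + ‖w‖) ^ 2 =
      (δ * ‖v‖ - ‖w‖) ^ 2 / δ := by
    field_simp
    ring
  have h3 : 0 ≤ (δ * ‖v‖ - ‖w‖) ^ 2 / δ := by positivity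
  linarith

set_option maxHeartbeats 800000 in
/-- The effect of one query on the part of the state with query register `x` and a fixed set of
other recorded inputs. Here `n₀` and `n₁` count the collisions recorded without and with the
input `x`, and at most `m` of the values at `x` create a new collision. -/
theorem sum_sum_sq_query_le (x : X) (φ : Y → (X → Y) → ℂ) (n₀ n₁ m : (X → Y) → ℕ)
    (h₀ : ∀ f y, n₀ (update f x y) = n₀ f) (hm : ∀ f y, m (update f x y) = m f)
    (h₀₁ : ∀ f, n₀ f ≤ n₁ f) (h₁₀ : ∀ f, n₁ f ≤ n₀ f + 1)
    (hcard : ∀ f, ((univ : Finset Y).filter fun y => n₀ f + 1 ≤ n₁ (update f x y)).card ≤ m f)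
    {δ : ℝ} (hδ : 0 < δ) (j : ℕ) (M : ℝ) (hM : 0 ≤ M) :
    ∑ u, ∑ f, ((if j + 1 ≤ n₀ f then (1 : ℝ) else 0) *
          ‖avgAt x (fun f' => φ (u - f' x) f') f‖ ^ 2 +
        (if j + 1 ≤ n₁ f then (1 : ℝ) else 0) *
          ‖φ (u - f x) f - avgAt x (fun f' => φ (u - f' x) f') f‖ ^ 2) ≤
      (1 + δ) * ∑ u, ∑ f, ((if j + 1 ≤ n₀ f then (1 : ℝ) else 0) * ‖avgAt x (φ u) f‖ ^ 2 +
        (if j + 1 ≤ n₁ f then (1 : ℝ) else 0) * ‖φ u f - avgAt x (φ u) f‖ ^ 2) +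
      (1 + 1 / δ) * (4 * (M / Fintype.card Y) *
        ∑ u, ∑ f, ((if j ≤ n₀ f then (1 : ℝ) else 0) * ‖avgAt x (φ u) f‖ ^ 2 +
          (if j ≤ n₁ f then (1 : ℝ) else 0) * ‖φ u f - avgAt x (φ u) f‖ ^ 2) +
        ∑ u, ∑ f, (if M < m f then (1 : ℝ) else 0) *
          (‖avgAt x (φ u) f‖ ^ 2 + ‖φ u f - avgAt x (φ u) f‖ ^ 2)) := by
  have hN : (0 : ℝ) < Fintype.card Y := by exact_mod_cast Fintype.card_pos
  set φ' : Y → (X → Y) → ℂ := fun u f => φ (u - f x) f with hφ'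
  set e : Y → (X → Y) → ℂ := fun u => avgAt x (φ u) with he
  set e' : Y → (X → Y) → ℂ := fun u => avgAt x (φ' u) with he'
  set a : Y → (X → Y) → ℂ := fun u f => φ u f - e u f with ha
  set a' : Y → (X → Y) → ℂ := fun u f => φ' u f - e' u f with ha'
  change ∑ u, ∑ f, ((if j + 1 ≤ n₀ f then (1 : ℝ) else 0) * ‖e' u f‖ ^ 2 +
        (if j + 1 ≤ n₁ f then (1 : ℝ) else 0) * ‖a' u f‖ ^ 2) ≤
      (1 + δ) * ∑ u, ∑ f, ((if j + 1 ≤ n₀ f then (1 : ℝ) else 0) * ‖e u f‖ ^ 2 +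
        (if j + 1 ≤ n₁ f then (1 : ℝ) else 0) * ‖a u f‖ ^ 2) +
      (1 + 1 / δ) * (4 * (M / Fintype.card Y) *
        ∑ u, ∑ f, ((if j ≤ n₀ f then (1 : ℝ) else 0) * ‖e u f‖ ^ 2 +
          (if j ≤ n₁ f then (1 : ℝ) else 0) * ‖a u f‖ ^ 2) +
        ∑ u, ∑ f, (if M < m f then (1 : ℝ) else 0) * (‖e u f‖ ^ 2 + ‖a u f‖ ^ 2))
  have hcons : ∀ d : (X → Y) → ℝ, (∀ f y, d (update f x y) = d f) →
      ∑ u, ∑ f, d f * (‖e' u f‖ ^ 2 + ‖a' u f‖ ^ 2) =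
        ∑ u, ∑ f, d f * (‖e u f‖ ^ 2 + ‖a u f‖ ^ 2) :=
    fun d hd => sum_sum_sq_query x d hd φ
  have heu : ∀ u f y, e u (update f x y) = e u f := fun u f y => avgAt_update x _ f y
  have heu' : ∀ u f y, e' u (update f x y) = e' u f := fun u f y => avgAt_update x _ f y
  have Sadd : ∀ G H : Y → (X → Y) → ℝ, ∑ u, ∑ f, (G u f + H u f) =
      ∑ u, ∑ f, G u f + ∑ u, ∑ f, H u f := by
    intro G H
    simp only [Finset.sum_add_distrib]
  have Smul : ∀ (c : ℝ) (G : Y → (X → Y) → ℝ), ∑ u, ∑ f, c * G u f = c * ∑ u, ∑ f, G u f := by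
    intro c G
    simp only [Finset.mul_sum]
  have hMN : 0 ≤ M / Fintype.card Y := by positivity
  set d₁ : (X → Y) → ℝ := fun f => if j + 1 ≤ n₀ f then 1 else 0 with hd₁
  set d₂ : (X → Y) → ℝ := fun f => if n₀ f = j ∧ (m f : ℝ) ≤ M then 1 else 0 with hd₂
  set d₃ : (X → Y) → ℝ := fun f => if M < m f then 1 else 0 with hd₃
  set d₄ : (X → Y) → ℝ := fun f => if j ≤ n₀ f then 1 else 0 with hd₄
  set b : (X → Y) → ℝ := fun f => if n₀ f + 1 ≤ n₁ f then 1 else 0 with hb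
  -- Either `j + 1` collisions exist without `x`, or `x` completes the last one. In the second case
  -- the number of completing values is bounded by `M` (`d₂`), or the exceptional event `d₃` holds.
  have hpt : ∀ u f, d₁ f * ‖e' u f‖ ^ 2 +
      (if j + 1 ≤ n₁ f then (1 : ℝ) else 0) * ‖a' u f‖ ^ 2 ≤
      d₁ f * (‖e' u f‖ ^ 2 + ‖a' u f‖ ^ 2) + b f * d₂ f * ‖a' u f‖ ^ 2 +
        d₃ f * (‖e' u f‖ ^ 2 + ‖a' u f‖ ^ 2) := by
    intro u f
    have k1 : 0 ≤ ‖e' u f‖ ^ 2 := by positivity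
    have k2 : 0 ≤ ‖a' u f‖ ^ 2 := by positivity
    have := h₀₁ f
    have := h₁₀ f
    simp only [hd₁, hd₂, hd₃, hb]
    by_cases c1 : j + 1 ≤ n₀ f
    · have c2 : j + 1 ≤ n₁ f := by omega
      have c3 : n₀ f ≠ j := by omega
      simp only [c1, c2, c3, if_true, false_and, if_false]
      split_ifs <;> nlinarith
    · by_cases c2 : j + 1 ≤ n₁ f
      · have c3 : n₀ f = j := by omega
        have c4 : n₀ f + 1 ≤ n₁ f := by omega
        by_cases c5 : M < m f
        · simp [c2, c3, c5, not_le.mpr c5, k1]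
        · simp [c2, c3, c5, not_lt.mp c5]
      · simp only [c1, c2, if_false]
        split_ifs <;> nlinarith
  -- The new recorded part is the shifted old recorded part plus a difference of unrecorded parts.
  -- Only this difference is paid for: as functions of `f`, `e u` and `e' u` do not see `f x`.
  have hpt2 : ∀ u f, b f * d₂ f * ‖a' u f‖ ^ 2 ≤ (1 + δ) * (b f * d₂ f * ‖a (u - f x) f‖ ^ 2) +
      (1 + 1 / δ) * (2 * (b f * (d₂ f * ‖e (u - f x) f‖ ^ 2)) +
        2 * (b f * (d₂ f * ‖e' u f‖ ^ 2))) := by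
    intro u f
    have k0 : 0 ≤ b f * d₂ f := by
      simp only [hb, hd₂]
      positivity
    have k1 : a' u f = a (u - f x) f + (e (u - f x) f - e' u f) := by
      simp only [ha', ha, hφ']
      ring
    have k2 : ‖e (u - f x) f - e' u f‖ ^ 2 ≤ 2 * ‖e (u - f x) f‖ ^ 2 + 2 * ‖e' u f‖ ^ 2 := by
      have := norm_add_sq_le_mul one_pos (e (u - f x) f) (-e' u f)
      rw [norm_neg, ← sub_eq_add_neg] at this
      linarith
    have k3 := norm_add_sq_le_mul hδ (a (u - f x) f) (e (u - f x) f - e' u f)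
    rw [← k1] at k3
    have k4 : (0 : ℝ) ≤ 1 + 1 / δ := by positivity
    have k5 := mul_le_mul_of_nonneg_left k2 k4
    have k6 := mul_le_mul_of_nonneg_left (k3.trans (add_le_add_right k5 _)) k0
    linarith
  have hshift : ∀ (c : (X → Y) → ℝ) (g : Y → (X → Y) → ℂ),
      ∑ u, ∑ f, c f * ‖g (u - f x) f‖ ^ 2 = ∑ u, ∑ f, c f * ‖g u f‖ ^ 2 := by
    intro c g
    refine Finset.sum_comm.trans (Eq.trans ?_ Finset.sum_comm)
    exact Finset.sum_congr rfl fun f _ =>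
      Equiv.sum_comp (Equiv.subRight (f x)) (fun u => c f * ‖g u f‖ ^ 2)
  have hd₁u : ∀ f y, d₁ (update f x y) = d₁ f := by intro f y; simp only [hd₁, h₀]
  have hd₂u : ∀ f y, d₂ (update f x y) = d₂ f := by intro f y; simp only [hd₂, h₀, hm]
  have hd₃u : ∀ f y, d₃ (update f x y) = d₃ f := by intro f y; simp only [hd₃, hm]
  have hd₄u : ∀ f y, d₄ (update f x y) = d₄ f := by intro f y; simp only [hd₄, h₀]
  have hd₂0 : ∀ f, 0 ≤ d₂ f := by intro f; simp only [hd₂]; positivity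
  have hd₄0 : ∀ f, 0 ≤ d₄ f := by intro f; simp only [hd₄]; positivity
  have hd₂₄ : ∀ f, d₂ f ≤ d₄ f := by
    intro f
    simp only [hd₂, hd₄]
    by_cases c : n₀ f = j
    · simp only [c, true_and, le_refl, if_true]
      split_ifs <;> norm_num
    · simp only [c, false_and, if_false]
      positivity
  -- a new collision arises from few of the values at `x`
  have hfiber : ∀ (g : Y → (X → Y) → ℂ), (∀ u f y, g u (update f x y) = g u f) →
      ∑ u, ∑ f, b f * (d₂ f * ‖g u f‖ ^ 2) ≤
        M / Fintype.card Y * ∑ u, ∑ f, d₂ f * ‖g u f‖ ^ 2 := by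
    intro g hg
    rw [Finset.mul_sum]
    refine Finset.sum_le_sum fun u _ => ?_
    rw [div_mul_eq_mul_div, le_div_iff₀ hN, mul_comm]
    refine card_mul_sum_mul_le x (fun f => d₂ f * ‖g u f‖ ^ 2) b M ?_ ?_ ?_
    · intro f y
      simp only [hd₂u, hg]
    · intro f
      have := hd₂0 f
      positivity
    · intro f hf
      have hf2 : (m f : ℝ) ≤ M := by
        by_contra hcon
        simp [hd₂, hcon] at hf
      refine le_trans ?_ hf2
      simp only [hb, h₀]
      rw [Finset.sum_boole]
      exact_mod_cast hcard f
  set B := ∑ u, ∑ f, d₄ f * (‖e u f‖ ^ 2 + ‖a u f‖ ^ 2) with hB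
  have hBe : ∑ u, ∑ f, d₂ f * ‖e u f‖ ^ 2 ≤ B := by
    refine Finset.sum_le_sum fun u _ => Finset.sum_le_sum fun f _ => ?_
    refine mul_le_mul (hd₂₄ f) ?_ (by positivity) (hd₄0 f)
    nlinarith [sq_nonneg ‖a u f‖]
  have hBe' : ∑ u, ∑ f, d₂ f * ‖e' u f‖ ^ 2 ≤ B := by
    rw [hB, ← hcons d₄ hd₄u]
    refine Finset.sum_le_sum fun u _ => Finset.sum_le_sum fun f _ => ?_
    refine mul_le_mul (hd₂₄ f) ?_ (by positivity) (hd₄0 f)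
    nlinarith [sq_nonneg ‖a' u f‖]
  have hBle : B ≤ ∑ u, ∑ f, (d₄ f * ‖e u f‖ ^ 2 +
      (if j ≤ n₁ f then (1 : ℝ) else 0) * ‖a u f‖ ^ 2) := by
    refine Finset.sum_le_sum fun u _ => Finset.sum_le_sum fun f _ => ?_
    rw [mul_add]
    refine add_le_add_right (mul_le_mul_of_nonneg_right ?_ (by positivity)) _
    simp only [hd₄]
    have := h₀₁ f
    by_cases c : j ≤ n₀ f
    · simp [c, c.trans this]
    · simp only [c, if_false]
      positivity
  have hmain : ∑ u, ∑ f, (d₁ f * ‖e' u f‖ ^ 2 +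
      (if j + 1 ≤ n₁ f then (1 : ℝ) else 0) * ‖a' u f‖ ^ 2) ≤
      ∑ u, ∑ f, d₁ f * (‖e u f‖ ^ 2 + ‖a u f‖ ^ 2) +
      ((1 + δ) * ∑ u, ∑ f, b f * d₂ f * ‖a u f‖ ^ 2 +
        (1 + 1 / δ) * (2 * (M / Fintype.card Y * B) + 2 * (M / Fintype.card Y * B))) +
      ∑ u, ∑ f, d₃ f * (‖e u f‖ ^ 2 + ‖a u f‖ ^ 2) := by
    refine (Finset.sum_le_sum fun u _ => Finset.sum_le_sum fun f _ => hpt u f).trans ?_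
    rw [Sadd, Sadd, hcons d₁ hd₁u, hcons d₃ hd₃u]
    gcongr
    refine (Finset.sum_le_sum fun u _ => Finset.sum_le_sum fun f _ => hpt2 u f).trans ?_
    rw [Sadd, Smul, Smul, Sadd, Smul, Smul, hshift (fun f => b f * d₂ f) a]
    have q1 : ∑ u, ∑ f, b f * (d₂ f * ‖e (u - f x) f‖ ^ 2) =
        ∑ u, ∑ f, b f * (d₂ f * ‖e u f‖ ^ 2) := by
      have := hshift (fun f => b f * d₂ f) e
      simpa only [mul_assoc] using this
    rw [q1]
    have q2 := (hfiber e heu).trans (mul_le_mul_of_nonneg_left hBe hMN)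
    have q3 := (hfiber e' heu').trans (mul_le_mul_of_nonneg_left hBe' hMN)
    gcongr
  -- The weights `d₁` and `b * d₂` have disjoint supports, both inside the event `j + 1 ≤ n₁`.
  have hfin : ∑ u, ∑ f, d₁ f * (‖e u f‖ ^ 2 + ‖a u f‖ ^ 2) +
      ∑ u, ∑ f, b f * d₂ f * ‖a u f‖ ^ 2 ≤ ∑ u, ∑ f, (d₁ f * ‖e u f‖ ^ 2 +
        (if j + 1 ≤ n₁ f then (1 : ℝ) else 0) * ‖a u f‖ ^ 2) := by
    rw [← Sadd]
    refine Finset.sum_le_sum fun u _ => Finset.sum_le_sum fun f _ => ?_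
    rw [mul_add, add_assoc, ← add_mul]
    refine add_le_add_right (mul_le_mul_of_nonneg_right ?_ (by positivity)) _
    have := h₀₁ f
    have := h₁₀ f
    simp only [hd₁, hd₂, hb]
    by_cases c1 : j + 1 ≤ n₀ f
    · have c2 : j + 1 ≤ n₁ f := by omega
      have c3 : n₀ f ≠ j := by omega
      simp [c1, c2, c3]
    · by_cases c3 : n₀ f = j
      · have c4 : ¬ j + 1 ≤ j := by omega
        simp only [c3, c4, if_false, true_and, zero_add]
        by_cases c5 : j + 1 ≤ n₁ f
        · simp only [c5, if_true, one_mul]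
          split_ifs <;> norm_num
        · simp only [c5, if_false, zero_mul, le_refl]
      · simp only [c1, c3, false_and, if_false, mul_zero, add_zero]
        positivity
  have hA0 : 0 ≤ ∑ u, ∑ f, d₁ f * (‖e u f‖ ^ 2 + ‖a u f‖ ^ 2) := by positivity
  have hD0 : 0 ≤ ∑ u, ∑ f, d₃ f * (‖e u f‖ ^ 2 + ‖a u f‖ ^ 2) := by positivity
  have hδ1 : 0 ≤ 1 / δ := by positivity
  have h4 := mul_le_mul_of_nonneg_left hfin (by positivity : 0 ≤ 1 + δ)
  have h5 := mul_le_mul_of_nonneg_left hBle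
    (by positivity : 0 ≤ (1 + 1 / δ) * (4 * (M / Fintype.card Y)))
  have h6 := mul_nonneg hδ.le hA0
  have h7 := mul_nonneg hδ1 hD0
  refine hmain.trans ?_
  linarith

end Block

theorem sqrt_le_sqrt_add_sqrt_of_forall {A' A B : ℝ} (hA : 0 ≤ A) (hB : 0 ≤ B)
    (h : ∀ δ : ℝ, 0 < δ → A' ≤ (1 + δ) * A + (1 + 1 / δ) * B) : √A' ≤ √A + √B := by
  refine Real.sqrt_le_iff.mpr ⟨by positivity, ?_⟩
  set r := √A with hr
  set s := √B with hs
  have hr0 : 0 ≤ r := Real.sqrt_nonneg _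
  have hs0 : 0 ≤ s := Real.sqrt_nonneg _
  have hA' : A = r ^ 2 := (Real.sq_sqrt hA).symm
  have hB' : B = s ^ 2 := (Real.sq_sqrt hB).symm
  have key : ∀ η : ℝ, 0 < η → A' ≤ (r + s) ^ 2 + η * (r + s) := by
    intro η hη
    -- The optimal `δ` is `s / r`; `η` keeps it defined and positive when `r` or `s` vanishes.
    have h1 := h ((s + η) / (r + η)) (by positivity)
    have h2 : (s + η) / (r + η) * r ^ 2 ≤ (s + η) * r := by
      rw [div_mul_eq_mul_div, div_le_iff₀ (by positivity)]
      have : 0 ≤ (s + η) * r * η := by positivity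
      nlinarith
    have h3 : 1 / ((s + η) / (r + η)) * s ^ 2 ≤ (r + η) * s := by
      rw [one_div_div, div_mul_eq_mul_div, div_le_iff₀ (by positivity)]
      have : 0 ≤ (r + η) * s * η := by positivity
      nlinarith
    rw [hA', hB'] at h1
    nlinarith
  refine le_of_forall_pos_le_add fun ε hε => ?_
  have h1 := key (ε / (r + s + 1)) (by positivity)
  have h2 : ε / (r + s + 1) * (r + s) ≤ ε := by
    rw [div_mul_eq_mul_div, div_le_iff₀ (by positivity)]
    nlinarith
  linarith

/-! ### Counting collisions inside the recorded set -/

section CollCount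

variable {X Y : Type*} [DecidableEq X] [Fintype Y] [DecidableEq Y]

/-- The number of pairwise disjoint `k`-collisions of `f` that can be found within `S`. -/
def collCount (k : ℕ) (S : Finset X) (f : X → Y) : ℕ :=
  ∑ y, (S.filter fun x => f x = y).card / k

theorem collCount_empty (k : ℕ) (f : X → Y) : collCount k ∅ f = 0 := by
  simp [collCount]

theorem collCount_update (k : ℕ) {x : X} {S : Finset X} (hx : x ∉ S) (f : X → Y) (y : Y) :
    collCount k S (update f x y) = collCount k S f := by
  unfold collCount
  refine Finset.sum_congr rfl fun y' _ => ?_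
  congr 2
  refine Finset.filter_congr fun x' hx' => ?_
  rw [update_of_ne (ne_of_mem_of_not_mem hx' hx)]

theorem collCount_insert (k : ℕ) {x : X} {S : Finset X} (hx : x ∉ S) (f : X → Y) :
    collCount k (insert x S) f =
      collCount k S f + if k ∣ (S.filter fun x' => f x' = f x).card + 1 then 1 else 0 := by
  unfold collCount
  rw [← Finset.add_sum_erase _ _ (Finset.mem_univ (f x)),
    ← Finset.add_sum_erase (a := f x) (s := univ)
      (f := fun y => (S.filter fun x => f x = y).card / k) (Finset.mem_univ (f x))]
  have h1 : ((insert x S).filter fun x' => f x' = f x).card =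
      (S.filter fun x' => f x' = f x).card + 1 := by
    rw [Finset.filter_insert, if_pos rfl, Finset.card_insert_of_notMem]
    simp [hx]
  have h2 : ∀ y ∈ univ.erase (f x), ((insert x S).filter fun x' => f x' = y).card / k =
      (S.filter fun x' => f x' = y).card / k := by
    intro y hy
    rw [Finset.filter_insert, if_neg (Finset.ne_of_mem_erase hy).symm]
  rw [h1, Finset.sum_congr rfl h2, Nat.succ_div]
  ring

theorem collCount_le_insert (k : ℕ) {x : X} {S : Finset X} (hx : x ∉ S) (f : X → Y) :
    collCount k S f ≤ collCount k (insert x S) f := by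
  rw [collCount_insert k hx]
  exact Nat.le_add_right _ _

theorem collCount_insert_le (k : ℕ) {x : X} {S : Finset X} (hx : x ∉ S) (f : X → Y) :
    collCount k (insert x S) f ≤ collCount k S f + 1 := by
  rw [collCount_insert k hx]
  split_ifs <;> simp

/-- A completing value already has at least `k` preimages in `S`, hence contributes at least one to
the count of `k`-collisions. -/
theorem card_filter_collCount_insert_le {k : ℕ} (hk : 1 ≤ k) {x : X} {S : Finset X}
    (hx : x ∉ S) (f : X → Y) :
    (univ.filter fun y => collCount (k + 1) S f + 1 ≤
      collCount (k + 1) (insert x S) (update f x y)).card ≤ collCount k S f := by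
  rw [Finset.card_filter]
  refine Finset.sum_le_sum fun y _ => ?_
  split_ifs with h
  · rw [collCount_insert _ hx, collCount_update _ hx, update_self] at h
    have h1 : (S.filter fun x' => update f x y x' = y).card = (S.filter fun x' => f x' = y).card := by
      congr 1
      refine Finset.filter_congr fun x' hx' => ?_
      rw [update_of_ne (ne_of_mem_of_not_mem hx' hx)]
    rw [h1] at h
    have h2 : k + 1 ∣ (S.filter fun x' => f x' = y).card + 1 := by
      by_contra hcon
      simp [hcon] at h
    have h3 := Nat.le_of_dvd (Nat.succ_pos _) h2
    exact (Nat.one_le_div_iff hk).mpr (by omega)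
  · exact Nat.zero_le _

/-- The indicator of the event that at least `j` disjoint `k`-collisions are recorded. -/
def collIndicator (k j : ℕ) (S : Finset X) (f : X → Y) : ℝ :=
  if j ≤ collCount k S f then 1 else 0

theorem collIndicator_nonneg (k j : ℕ) (S : Finset X) (f : X → Y) :
    0 ≤ collIndicator k j S f := by
  unfold collIndicator
  positivity

end CollCount

/-! ### Weighted mass of the components and its growth under a query -/

section Mass

variable {X Y Z : Type*} [Fintype X] [DecidableEq X] [Fintype Y] [DecidableEq Y] [Fintype Z]

/-- The squared norm of the components of an oracle-dependent state, weighted by `w`. -/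
noncomputable def componentMass (w : Finset X → (X → Y) → ℝ)
    (ψ : (X → Y) → RegisterSpace X Y Z) : ℝ :=
  ∑ S, ∑ f, w S f * ‖component S univ ψ f‖ ^ 2

theorem componentMass_nonneg {w : Finset X → (X → Y) → ℝ} (hw : ∀ S f, 0 ≤ w S f)
    (ψ : (X → Y) → RegisterSpace X Y Z) : 0 ≤ componentMass w ψ :=
  Finset.sum_nonneg fun S _ => Finset.sum_nonneg fun f _ => mul_nonneg (hw S f) (by positivity)

/-- The unitary acts on the registers and `component` on the oracle's values, so the two commute. -/
theorem componentMass_isometry (w : Finset X → (X → Y) → ℝ)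
    (U : RegisterSpace X Y Z ≃ₗᵢ[ℂ] RegisterSpace X Y Z) (ψ : (X → Y) → RegisterSpace X Y Z) :
    componentMass w (fun f => U (ψ f)) = componentMass w ψ := by
  unfold componentMass
  refine Finset.sum_congr rfl fun S _ => Finset.sum_congr rfl fun f _ => ?_
  have h := map_component (U.toLinearEquiv : RegisterSpace X Y Z →ₗ[ℂ] RegisterSpace X Y Z)
    S univ ψ f
  have h2 : U (component S univ ψ f) = component S univ (fun f => U (ψ f)) f := h
  rw [← h2, U.norm_map]

theorem component_apply (S R : Finset X) (ψ : (X → Y) → RegisterSpace X Y Z) (f : X → Y)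
    (b : X × Y × Z) : component S R ψ f b = component S R (fun f' => ψ f' b) f := by
  simp [component]

theorem componentMass_eq_sum_coord (w : Finset X → (X → Y) → ℝ)
    (ψ : (X → Y) → RegisterSpace X Y Z) :
    componentMass w ψ =
      ∑ b, ∑ S, ∑ f, w S f * ‖component S univ (fun f' => ψ f' b) f‖ ^ 2 := by
  unfold componentMass
  simp_rw [EuclideanSpace.norm_sq_eq, Finset.mul_sum, component_apply]
  exact (Finset.sum_congr rfl fun S _ => Finset.sum_comm).trans Finset.sum_comm

/-- Splitting the components according to whether the query register is recorded. -/
theorem componentMass_eq_sum_block (w : Finset X → (X → Y) → ℝ)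
    (ψ : (X → Y) → RegisterSpace X Y Z) :
    componentMass w ψ = ∑ x, ∑ z, ∑ S ∈ (univ.erase x).powerset, ∑ u, ∑ f,
      (w S f * ‖avgAt x (component S (univ.erase x) fun f' => ψ f' (x, u, z)) f‖ ^ 2 +
        w (insert x S) f * ‖component S (univ.erase x) (fun f' => ψ f' (x, u, z)) f -
          avgAt x (component S (univ.erase x) fun f' => ψ f' (x, u, z)) f‖ ^ 2) := by
  rw [componentMass_eq_sum_coord, Fintype.sum_prod_type]
  refine Finset.sum_congr rfl fun x _ => ?_
  rw [Fintype.sum_prod_type, Finset.sum_comm]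
  refine Finset.sum_congr rfl fun z _ => ?_
  refine Finset.sum_comm.trans ?_
  rw [sum_finset_eq_sum_powerset_erase x]
  refine Finset.sum_congr rfl fun S hS => ?_
  have hSx : x ∉ S := fun h => by simpa using Finset.mem_powerset.mp hS h
  rw [← Finset.sum_add_distrib]
  refine Finset.sum_congr rfl fun u _ => ?_
  rw [← Finset.sum_add_distrib]
  refine Finset.sum_congr rfl fun f _ => ?_
  have h1 := avgAt_component x hSx (Finset.notMem_erase x univ) (fun f' => ψ f' (x, u, z))
  have h2 := component_insert_insert x hSx (Finset.notMem_erase x univ)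
    (fun f' => ψ f' (x, u, z)) f
  rw [Finset.insert_erase (Finset.mem_univ x)] at h1 h2
  rw [h1, h2]

variable [AddCommGroup Y]

theorem queryOracle_apply (f : X → Y) (v : RegisterSpace X Y Z) (x : X) (u : Y) (z : Z) :
    queryOracle Z f v (x, u, z) = v (x, u - f x, z) := rfl

theorem component_query (x : X) {S : Finset X} (hS : x ∉ S) (u : Y) (z : Z)
    (ψ : (X → Y) → RegisterSpace X Y Z) :
    (component S (univ.erase x) fun f' => queryOracle Z f' (ψ f') (x, u, z)) =
      fun f => component S (univ.erase x) (fun f' => ψ f' (x, u - f x, z)) f := by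
  funext f
  simp_rw [queryOracle_apply]
  exact component_apply_self x hS (Finset.notMem_erase x univ)
    (fun y f' => ψ f' (x, u - y, z)) f

/-- Recording or erasing one input changes the count by at most one. The event for `S` alone is
therefore a suitable intermediate weight, which the query conserves. -/
theorem componentMass_query_succ_le (k j : ℕ) (ψ : (X → Y) → RegisterSpace X Y Z) :
    componentMass (collIndicator k (j + 1)) (fun f => queryOracle Z f (ψ f)) ≤
      componentMass (collIndicator k j) ψ := by
  rw [componentMass_eq_sum_block, componentMass_eq_sum_block]
  refine Finset.sum_le_sum fun x _ => Finset.sum_le_sum fun z _ => Finset.sum_le_sum fun S hS => ?_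
  have hSx : x ∉ S := fun h => by simpa using Finset.mem_powerset.mp hS h
  simp_rw [component_query x hSx]
  have h1 := sum_sum_sq_query x (fun f => collIndicator k j S f)
    (by intro f y; simp [collIndicator, collCount_update k hSx])
    (fun u f => component S (univ.erase x) (fun f' => ψ f' (x, u, z)) f)
  calc _ ≤ _ := ?_
    _ = _ := h1
    _ ≤ _ := ?_
  · refine Finset.sum_le_sum fun u _ => Finset.sum_le_sum fun f _ => ?_
    rw [mul_add]
    have := collCount_insert_le k hSx f
    refine add_le_add (mul_le_mul_of_nonneg_right ?_ (by positivity))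
      (mul_le_mul_of_nonneg_right ?_ (by positivity)) <;>
    · unfold collIndicator
      split_ifs <;> first | omega | norm_num
  · refine Finset.sum_le_sum fun u _ => Finset.sum_le_sum fun f _ => ?_
    rw [mul_add]
    have := collCount_le_insert k hSx f
    refine add_le_add_right (mul_le_mul_of_nonneg_right ?_ (by positivity)) _
    unfold collIndicator
    split_ifs <;> first | omega | norm_num

theorem componentMass_query_le {k : ℕ} (hk : 1 ≤ k) (j M : ℕ)
    (ψ : (X → Y) → RegisterSpace X Y Z) {δ : ℝ} (hδ : 0 < δ) :
    componentMass (collIndicator (k + 1) (j + 1)) (fun f => queryOracle Z f (ψ f)) ≤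
      (1 + δ) * componentMass (collIndicator (k + 1) (j + 1)) ψ +
      (1 + 1 / δ) * (4 * (M / Fintype.card Y) * componentMass (collIndicator (k + 1) j) ψ +
        componentMass (collIndicator k (M + 1)) ψ) := by
  simp_rw [componentMass_eq_sum_block, Finset.mul_sum, ← Finset.sum_add_distrib, Finset.mul_sum,
    ← Finset.sum_add_distrib]
  refine Finset.sum_le_sum fun x _ => Finset.sum_le_sum fun z _ => Finset.sum_le_sum fun S hS => ?_
  have hSx : x ∉ S := fun h => by simpa using Finset.mem_powerset.mp hS h
  simp_rw [component_query x hSx]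
  have h1 := sum_sum_sq_query_le x
    (fun u f => component S (univ.erase x) (fun f' => ψ f' (x, u, z)) f)
    (fun f => collCount (k + 1) S f) (fun f => collCount (k + 1) (insert x S) f)
    (fun f => collCount k S f) (collCount_update _ hSx) (collCount_update _ hSx)
    (collCount_le_insert _ hSx) (collCount_insert_le _ hSx)
    (card_filter_collCount_insert_le hk hSx) hδ j M (Nat.cast_nonneg M)
  refine h1.trans ?_
  simp_rw [Finset.mul_sum, ← Finset.sum_add_distrib, Finset.mul_sum, ← Finset.sum_add_distrib]
  refine Finset.sum_le_sum fun u _ => Finset.sum_le_sum fun f _ => ?_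
  refine add_le_add_right (mul_le_mul_of_nonneg_left (add_le_add_right ?_ _) (by positivity)) _
  rw [mul_add]
  have := collCount_le_insert k hSx f
  have h2 : ((M : ℝ) < (collCount k S f : ℝ)) ↔ M + 1 ≤ collCount k S f := by
    rw [Nat.cast_lt]
    rfl
  simp_rw [h2]
  refine add_le_add_right (mul_le_mul_of_nonneg_right ?_ (by positivity)) _
  unfold collIndicator
  split_ifs <;> first | omega | norm_num

end Mass

/-! ### Collision families and their supports -/

section CollisionFamily

variable {X Y : Type*} [Fintype X] [DecidableEq X] [Fintype Y] [DecidableEq Y]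

/-- The members with a given image `y` are disjoint `k`-subsets of the fibre over `y`; their number
is summed over `y`. -/
theorem IsCollisionFamily.le_collCount {k j : ℕ} (hk : 1 ≤ k) {f : X → Y}
    {C : Finset (Finset X)} (hC : IsCollisionFamily k j f C) {S : Finset X}
    (hS : C.biUnion id ⊆ S) : j ≤ collCount k S f := by
  obtain ⟨hcard, hcoll, hdisj⟩ := hC
  set D : Y → Finset (Finset X) := fun y => C.filter fun T => ∀ x ∈ T, f x = y with hD
  have h1 : ∀ y, (D y).card ≤ (S.filter fun x => f x = y).card / k := by
    intro y
    rw [Nat.le_div_iff_mul_le hk]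
    have h2 : ((D y).biUnion id).card = (D y).card * k := by
      rw [Finset.card_biUnion]
      · refine Finset.sum_const_nat fun T hT => (hcoll T ?_).1
        exact (Finset.mem_filter.mp hT).1
      · intro T hT T' hT' hne
        exact hdisj T (Finset.mem_filter.mp hT).1 T' (Finset.mem_filter.mp hT').1 hne
    rw [← h2]
    refine Finset.card_le_card fun x hx => ?_
    obtain ⟨T, hT, hxT⟩ := Finset.mem_biUnion.mp hx
    obtain ⟨hTC, hTy⟩ := Finset.mem_filter.mp hT
    exact Finset.mem_filter.mpr ⟨hS (Finset.mem_biUnion.mpr ⟨T, hTC, hxT⟩), hTy x hxT⟩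
  have h3 : C ⊆ univ.biUnion D := by
    intro T hT
    obtain ⟨hTk, hTf⟩ := hcoll T hT
    obtain ⟨x, hx⟩ : T.Nonempty := Finset.card_pos.mp (by omega)
    exact Finset.mem_biUnion.mpr ⟨f x, Finset.mem_univ _,
      Finset.mem_filter.mpr ⟨hT, fun x' hx' => hTf x' hx' x hx⟩⟩
  calc j = C.card := hcard.symm
    _ ≤ (univ.biUnion D).card := Finset.card_le_card h3
    _ ≤ ∑ y, (D y).card := Finset.card_biUnion_le
    _ ≤ collCount k S f := Finset.sum_le_sum fun y _ => h1 y

theorem isCollisionFamily_update {k j : ℕ} {C : Finset (Finset X)} {x : X}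
    (hx : x ∉ C.biUnion id) (f : X → Y) (y : Y) :
    IsCollisionFamily k j (update f x y) C ↔ IsCollisionFamily k j f C := by
  have h : ∀ S ∈ C, ∀ x' ∈ S, update f x y x' = f x' := by
    intro S hS x' hx'
    refine update_of_ne (fun h => hx ?_) _ _
    exact Finset.mem_biUnion.mpr ⟨S, hS, h ▸ hx'⟩
  unfold IsCollisionFamily IsMultiCollision
  refine and_congr_right fun _ => and_congr_left fun _ => forall₂_congr fun S hS =>
    and_congr_right fun _ => forall₂_congr fun a ha => forall₂_congr fun b hb => ?_
  rw [h S hS a ha, h S hS b hb]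

/-- Since `k ≥ 2`, the input `x` has a partner in its collision, whose value dictates the one at
`x`. -/
theorem IsCollisionFamily.update_inj {k j : ℕ} (hk : 2 ≤ k) {C : Finset (Finset X)} {x : X}
    (hx : x ∈ C.biUnion id) {f : X → Y} {y y' : Y} (h : IsCollisionFamily k j (update f x y) C)
    (h' : IsCollisionFamily k j (update f x y') C) : y = y' := by
  obtain ⟨S, hS, hxS⟩ := Finset.mem_biUnion.mp hx
  obtain ⟨hcard, hf⟩ := h.2.1 S hS
  obtain ⟨_, hf'⟩ := h'.2.1 S hS
  obtain ⟨x', hx', hne⟩ := Finset.exists_mem_ne (by omega : 1 < S.card) x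
  have h1 := hf x hxS x' hx'
  have h2 := hf' x hxS x' hx'
  rw [update_self, update_of_ne hne] at h1 h2
  rw [h1, h2]

theorem IsCollisionFamily.card_biUnion_le {k j : ℕ} {f : X → Y} {C : Finset (Finset X)}
    (hC : IsCollisionFamily k j f C) : (C.biUnion id).card ≤ k * j := by
  refine Finset.card_biUnion_le.trans ?_
  rw [Finset.sum_congr rfl fun S hS => show (id S).card = k from (hC.2.1 S hS).1]
  simp [hC.1, mul_comm]

end CollisionFamily

/-! ### A successful output is mostly recorded -/

section Output

variable {X Y : Type*} [Fintype X] [DecidableEq X] [Fintype Y] [DecidableEq Y] [Nonempty Y]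

theorem sum_sq_component_self_le (W : Finset X) (g : (X → Y) → ℂ) :
    ∑ f, ‖component W W g f‖ ^ 2 ≤ ∑ f, ‖g f‖ ^ 2 := by
  have h := sum_sum_sq_component ∅ W (Finset.disjoint_empty_left W) (fun _ => 1)
    (fun _ _ _ _ => rfl) g
  simp only [one_mul, Finset.empty_union, component_empty_empty] at h
  rw [← h]
  exact Finset.single_le_sum (f := fun S => ∑ f, ‖component S W g f‖ ^ 2)
    (fun S _ => by positivity) (Finset.mem_powerset_self W)

theorem sum_sq_avgAt_le (x : X) (g : (X → Y) → ℂ) :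
    ∑ f, ‖avgAt x g f‖ ^ 2 ≤ ∑ f, ‖g f‖ ^ 2 := by
  have h := sum_sq_avgAt_add x (fun _ => 1) (fun _ _ => rfl) g
  simp only [one_mul] at h
  rw [← h]
  exact Finset.sum_le_sum fun f _ => le_add_of_nonneg_right (by positivity)

/-- On an event that allows at most one value at each input in `W`, a function is close to its
part in which all of `W` is recorded. -/
theorem sum_sq_sub_component_le (W : Finset X) (d : (X → Y) → ℝ) (hd0 : ∀ f, 0 ≤ d f)
    (hd : ∀ x ∈ W, ∀ f, ∑ y, d (update f x y) ≤ 1) (g : (X → Y) → ℂ) :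
    ∑ f, d f * ‖g f - component W W g f‖ ^ 2 ≤
      (W.card : ℝ) ^ 2 / Fintype.card Y * ∑ f, ‖g f‖ ^ 2 := by
  have hN : (0 : ℝ) < Fintype.card Y := by exact_mod_cast Fintype.card_pos
  induction W using Finset.induction_on with
  | empty => simp [component_empty_empty]
  | insert x W hx ih =>
    have ih' := ih fun x' hx' => hd x' (Finset.mem_insert_of_mem hx')
    set G := component W W g with hG
    set A := ∑ f, ‖g f‖ ^ 2 with hA
    have hA0 : 0 ≤ A := by positivity
    have h1 : ∀ f, g f - component (insert x W) (insert x W) g f =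
        (g f - G f) + avgAt x G f := by
      intro f
      rw [component_insert_insert x hx hx, hG, avgAt_component x hx hx]
      ring
    have h2 : ∑ f, d f * ‖avgAt x G f‖ ^ 2 ≤ 1 / Fintype.card Y * A := by
      have h3 := card_mul_sum_mul_le x (fun f => ‖avgAt x G f‖ ^ 2) d 1
        (by intro f y; simp only [avgAt_update]) (fun f => by positivity)
        (fun f _ => hd x (Finset.mem_insert_self x W) f)
      rw [div_mul_eq_mul_div, le_div_iff₀ hN, mul_comm]
      refine h3.trans (mul_le_mul_of_nonneg_left ?_ zero_le_one)
      exact (sum_sq_avgAt_le x G).trans (sum_sq_component_self_le W g)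
    simp_rw [h1]
    rw [Finset.card_insert_of_notMem hx]
    rcases Nat.eq_zero_or_pos W.card with h0 | h0
    · rw [Finset.card_eq_zero] at h0
      subst h0
      have h4 : G = g := component_empty_empty g
      rw [h4] at h2
      simpa [h4] using h2
    · have hn : (0 : ℝ) < W.card := by exact_mod_cast h0
      -- With `w = W.card`, the choice `δ = 1 / w` gives `(1 + 1/w) w² + (1 + w) = (w + 1)²`; this
      -- is why `w = 0` is treated apart.
      have h5 : ∑ f, d f * ‖(g f - G f) + avgAt x G f‖ ^ 2 ≤
          (1 + 1 / (W.card : ℝ)) * ∑ f, d f * ‖g f - G f‖ ^ 2 +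
          (1 + 1 / (1 / (W.card : ℝ))) * ∑ f, d f * ‖avgAt x G f‖ ^ 2 := by
        rw [Finset.mul_sum, Finset.mul_sum, ← Finset.sum_add_distrib]
        refine Finset.sum_le_sum fun f _ => ?_
        have := mul_le_mul_of_nonneg_left (norm_add_sq_le_mul (one_div_pos.mpr hn)
          (g f - G f) (avgAt x G f)) (hd0 f)
        linarith
      refine h5.trans ?_
      have h6 := mul_le_mul_of_nonneg_left ih' (by positivity : 0 ≤ 1 + 1 / (W.card : ℝ))
      have h7 := mul_le_mul_of_nonneg_left h2 (by positivity : 0 ≤ 1 + 1 / (1 / (W.card : ℝ)))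
      refine (add_le_add h6 h7).trans (le_of_eq ?_)
      push_cast
      field_simp
      ring

/-- The event `d` ignores the values outside `W`, so the part with `W` recorded splits orthogonally
on it over all `S ⊇ W`, and on each such `S` the indicator dominates `d`. -/
theorem sum_sq_component_self_le_collIndicator {k j : ℕ} (W : Finset X) (d : (X → Y) → ℝ)
    (hd : ∀ x ∉ W, ∀ f y, d (update f x y) = d f)
    (hdW : ∀ S, W ⊆ S → ∀ f, d f ≤ collIndicator k j S f) (g : (X → Y) → ℂ) :
    ∑ f, d f * ‖component W W g f‖ ^ 2 ≤
      ∑ S, ∑ f, collIndicator k j S f * ‖component S univ g f‖ ^ 2 := by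
  rw [← sum_sum_sq_component W Wᶜ disjoint_compl_right d
    (fun x hx => hd x (Finset.mem_compl.mp hx)), Finset.union_compl]
  have hinj : Set.InjOn (fun S => W ∪ S) (Wᶜ.powerset : Set (Finset X)) := by
    intro S hS T hT h
    have hS' := Finset.mem_powerset.mp hS
    have hT' := Finset.mem_powerset.mp hT
    ext x
    have h1 : x ∈ W ∪ S ↔ x ∈ W ∪ T := by rw [show W ∪ S = W ∪ T from h]
    have h2 : x ∈ S → x ∉ W := fun h => Finset.mem_compl.mp (hS' h)
    have h3 : x ∈ T → x ∉ W := fun h => Finset.mem_compl.mp (hT' h)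
    simp only [Finset.mem_union] at h1
    tauto
  rw [← Finset.sum_image (f := fun S => ∑ f, d f * ‖component S univ g f‖ ^ 2)
    (g := fun S => W ∪ S) hinj]
  refine (Finset.sum_le_sum fun S hS => Finset.sum_le_sum fun f _ => ?_).trans
    (Finset.sum_le_sum_of_subset_of_nonneg (Finset.subset_univ _) fun S _ _ => ?_)
  · obtain ⟨T, _, rfl⟩ := Finset.mem_image.mp hS
    exact mul_le_mul_of_nonneg_right (hdW _ Finset.subset_union_left f) (by positivity)
  · exact Finset.sum_nonneg fun f _ => mul_nonneg (collIndicator_nonneg _ _ _ _) (by positivity)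

-- For each measurement outcome, `W` is the union of the output collisions. The part with all of `W`
-- recorded is charged to the recorded mass, the rest to guessing.
open Classical in
theorem sum_sum_sq_isCollisionFamily_le {Z : Type*} [Fintype Z] {k : ℕ} (hk : 2 ≤ k) (j : ℕ)
    (out : X × Y × Z → Finset (Finset X)) (ψ : (X → Y) → RegisterSpace X Y Z) {δ : ℝ}
    (hδ : 0 < δ) :
    ∑ f, ∑ b, (if IsCollisionFamily k j f (out b) then ‖ψ f b‖ ^ 2 else 0) ≤
      (1 + δ) * componentMass (collIndicator k j) ψ +
      (1 + 1 / δ) * (((k * j : ℕ) : ℝ) ^ 2 / Fintype.card Y * ∑ f, ‖ψ f‖ ^ 2) := by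
  simp_rw [componentMass_eq_sum_coord, EuclideanSpace.norm_sq_eq]
  rw [Finset.sum_comm, Finset.sum_comm (f := fun (f : X → Y) b => ‖ψ f b‖ ^ 2), Finset.mul_sum,
    Finset.mul_sum, Finset.mul_sum, ← Finset.sum_add_distrib]
  refine Finset.sum_le_sum fun b _ => ?_
  set C := out b
  set W := C.biUnion id with hW
  set g : (X → Y) → ℂ := fun f => ψ f b with hg
  set d : (X → Y) → ℝ := fun f => if IsCollisionFamily k j f C then 1 else 0 with hd
  have hd0 : ∀ f, 0 ≤ d f := by
    intro f
    simp only [hd]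
    positivity
  have h1 : ∑ f, d f * ‖g f‖ ^ 2 ≤ (1 + δ) * ∑ f, d f * ‖component W W g f‖ ^ 2 +
      (1 + 1 / δ) * ∑ f, d f * ‖g f - component W W g f‖ ^ 2 := by
    rw [Finset.mul_sum, Finset.mul_sum, ← Finset.sum_add_distrib]
    refine Finset.sum_le_sum fun f _ => ?_
    have h2 := mul_le_mul_of_nonneg_left (norm_add_sq_le_mul hδ (component W W g f)
      (g f - component W W g f)) (hd0 f)
    rw [add_sub_cancel] at h2
    linarith
  have h2 : ∑ f, (if IsCollisionFamily k j f C then ‖ψ f b‖ ^ 2 else 0) =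
      ∑ f, d f * ‖g f‖ ^ 2 := by
    refine Finset.sum_congr rfl fun f _ => ?_
    simp only [hd, hg, ite_mul, one_mul, zero_mul]
  rw [h2]
  refine h1.trans (add_le_add (mul_le_mul_of_nonneg_left ?_ (by positivity))
    (mul_le_mul_of_nonneg_left ?_ (by positivity)))
  · refine sum_sq_component_self_le_collIndicator W d ?_ ?_ g
    · intro x hx f y
      simp only [hd, isCollisionFamily_update hx]
    · intro S hS f
      simp only [hd, collIndicator]
      by_cases h : IsCollisionFamily k j f C
      · simp [h, h.le_collCount (by omega) hS]
      · simp only [h, if_false]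
        positivity
  -- The bound `k * j` on the size of `W` is available only if the output is a valid family for some
  -- `f`; otherwise the event is empty.
  · by_cases hex : ∃ f : X → Y, IsCollisionFamily k j f C
    · obtain ⟨f₀, hf₀⟩ := hex
      refine (sum_sq_sub_component_le W d hd0 ?_ g).trans ?_
      · intro x hx f
        simp only [hd]
        rw [Finset.sum_boole]
        have : (univ.filter fun y => IsCollisionFamily k j (update f x y) C).card ≤ 1 :=
          Finset.card_le_one.mpr fun y hy y' hy' =>
            IsCollisionFamily.update_inj hk hx (Finset.mem_filter.mp hy).2
              (Finset.mem_filter.mp hy').2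
        exact_mod_cast this
      · have h3 : (W.card : ℝ) ≤ ((k * j : ℕ) : ℝ) := by exact_mod_cast hf₀.card_biUnion_le
        gcongr
    · have h3 : ∀ f, d f = 0 := by
        intro f
        simp only [hd]
        rw [if_neg fun h => hex ⟨f, h⟩]
      simp only [h3, zero_mul, Finset.sum_const_zero]
      positivity

end Output

/-! ### Solving the recurrence -/

theorem sqrt_add_le_sqrt_add_sqrt {a b : ℝ} (ha : 0 ≤ a) (hb : 0 ≤ b) : √(a + b) ≤ √a + √b := by
  refine Real.sqrt_le_iff.mpr ⟨by positivity, ?_⟩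
  nlinarith [Real.sq_sqrt ha, Real.sq_sqrt hb, mul_nonneg (Real.sqrt_nonneg a) (Real.sqrt_nonneg b)]

/-- A Chernoff-type bound: `t ^ j` is multiplied by `1 + a / t` under the homogeneous recurrence.
The constant error grows by `1 + a` per step, plus a fresh `ε`. The parameter `t` is free, to be
tuned to the threshold. -/
theorem le_of_add_recurrence (F : ℕ → ℕ → ℝ) (q : ℕ) {a ε t L : ℝ} (ha : 0 ≤ a) (hε : 0 ≤ ε)
    (ht : 0 < t) (hL : q * a ≤ L) (h0 : ∀ i, F i 0 ≤ 1) (h1 : ∀ j, F 0 (j + 1) ≤ 0)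
    (hF : ∀ i j, i < q → F (i + 1) (j + 1) ≤ F i (j + 1) + a * F i j + ε)
    {i : ℕ} (hi : i ≤ q) (j : ℕ) :
    F i j ≤ Real.exp (L / t) * t ^ j + q * Real.exp L * ε := by
  have key : ∀ i, i ≤ q → ∀ j, F i j ≤ (1 + a / t) ^ i * t ^ j + i * (1 + a) ^ i * ε := by
    intro i
    induction i with
    | zero =>
      intro _ j
      cases j with
      | zero => simpa using h0 0
      | succ j =>
        refine (h1 j).trans ?_
        positivity
    | succ i ih =>
      intro hi j
      cases j with
      | zero =>
        refine (h0 _).trans ?_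
        have h2 : (1 : ℝ) ≤ (1 + a / t) ^ (i + 1) :=
          one_le_pow₀ (by linarith [div_nonneg ha ht.le])
        have h3 : 0 ≤ ((i + 1 : ℕ) : ℝ) * (1 + a) ^ (i + 1) * ε := by positivity
        rw [pow_zero, mul_one]
        linarith
      | succ j =>
        have h2 := ih (by omega) (j + 1)
        have h3 := mul_le_mul_of_nonneg_left (ih (by omega) j) ha
        have h4 := hF i j (by omega)
        have h5 : a * ((1 + a / t) ^ i * t ^ j) = a / t * (1 + a / t) ^ i * t ^ (j + 1) := by
          field_simp
          ring
        have h6 : (1 : ℝ) ≤ (1 + a) ^ (i + 1) := one_le_pow₀ (by linarith)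
        have h7 := mul_le_mul_of_nonneg_right h6 hε
        push_cast
        rw [mul_add, h5] at h3
        have h8 : (1 + a / t) ^ (i + 1) * t ^ (j + 1) =
            (1 + a / t) ^ i * t ^ (j + 1) + a / t * (1 + a / t) ^ i * t ^ (j + 1) := by ring
        have h9 : ((i : ℝ) + 1) * (1 + a) ^ (i + 1) * ε =
            i * (1 + a) ^ i * ε + a * (i * (1 + a) ^ i * ε) + (1 + a) ^ (i + 1) * ε := by ring
        rw [h8, h9]
        linarith
  have hexp : ∀ b : ℝ, 0 ≤ b → ∀ B : ℝ, q * b ≤ B → (1 + b) ^ i ≤ Real.exp B := by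
    intro b hb B hB
    have h2 : 1 + b ≤ Real.exp b := by
      rw [add_comm]
      exact Real.add_one_le_exp b
    have h3 : (i : ℝ) * b ≤ B :=
      (mul_le_mul_of_nonneg_right (Nat.cast_le.mpr hi) hb).trans hB
    calc (1 + b) ^ i ≤ Real.exp b ^ i := by gcongr
      _ = Real.exp (i * b) := (Real.exp_nat_mul b i).symm
      _ ≤ Real.exp B := Real.exp_le_exp.mpr h3
  refine (key i hi j).trans ?_
  have h2 := hexp (a / t) (by positivity) (L / t) (by
    rw [← mul_div_assoc]
    gcongr)
  have h3 := hexp a ha L hL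
  have h4 : (i : ℝ) ≤ q := Nat.cast_le.mpr hi
  gcongr

/-! ### Amplitudes of recorded collisions -/

namespace QuantumQueryAlgorithm

section Amplitude

variable {X Y Z O : Type*} [Fintype X] [DecidableEq X] [Fintype Y] [DecidableEq Y]
  [AddCommGroup Y] [Fintype Z]

theorem norm_stateAfter (A : QuantumQueryAlgorithm X Y Z O) (f : X → Y) (i : ℕ) :
    ‖A.stateAfter f i‖ = 1 := by
  induction i with
  | zero => exact A.norm_init
  | succ i ih => rw [stateAfter, LinearIsometryEquiv.norm_map, LinearIsometryEquiv.norm_map, ih]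

/-- The amplitude, averaged over all oracles, with which at least `j` disjoint `k`-collisions are
recorded after `i` queries. -/
noncomputable def collAmplitude (A : QuantumQueryAlgorithm X Y Z O) (k j i : ℕ) : ℝ :=
  √(componentMass (collIndicator k j) (fun f => A.stateAfter f i) / Fintype.card (X → Y))

theorem collAmplitude_le_of_le (A : QuantumQueryAlgorithm X Y Z O) {k j k' j' i i' : ℕ}
    (h : componentMass (collIndicator k j) (fun f => A.stateAfter f i) ≤
      componentMass (collIndicator k' j') (fun f => A.stateAfter f i')) :
    A.collAmplitude k j i ≤ A.collAmplitude k' j' i' :=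
  Real.sqrt_le_sqrt (div_le_div_of_nonneg_right h (Nat.cast_nonneg _))

theorem collAmplitude_le_one (A : QuantumQueryAlgorithm X Y Z O) (k j i : ℕ) :
    A.collAmplitude k j i ≤ 1 := by
  refine Real.sqrt_le_one.mpr (div_le_one_of_le₀ ?_ (Nat.cast_nonneg _))
  have h1 : componentMass (collIndicator k j) (fun f => A.stateAfter f i) ≤
      componentMass (fun _ _ => 1) (fun f => A.stateAfter f i) := by
    refine Finset.sum_le_sum fun S _ => Finset.sum_le_sum fun f _ =>
      mul_le_mul_of_nonneg_right ?_ (by positivity)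
    unfold collIndicator
    split_ifs <;> norm_num
  refine h1.trans (le_of_eq ?_)
  rw [componentMass_eq_sum_coord]
  have h2 : ∀ b, ∑ S, ∑ f, (1 : ℝ) * ‖component S univ (fun f' => A.stateAfter f' i b) f‖ ^ 2 =
      ∑ f, ‖A.stateAfter f i b‖ ^ 2 := by
    intro b
    -- Parseval: the squared norms of all components add up to that of the state.
    have h := sum_sum_sq_component ∅ univ (Finset.disjoint_empty_left univ) (fun _ => 1)
      (fun _ _ _ _ => rfl) (fun f' : X → Y => A.stateAfter f' i b)
    simpa only [Finset.empty_union, component_empty_empty, Finset.powerset_univ, one_mul] using h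
  simp_rw [h2]
  rw [Finset.sum_comm]
  simp_rw [← EuclideanSpace.norm_sq_eq, norm_stateAfter]
  simp

theorem collAmplitude_succ_zero (A : QuantumQueryAlgorithm X Y Z O) (k j : ℕ) :
    A.collAmplitude k (j + 1) 0 = 0 := by
  have h : componentMass (collIndicator k (j + 1)) (fun f => A.stateAfter f 0) = 0 := by
    refine Finset.sum_eq_zero fun S _ => Finset.sum_eq_zero fun f _ => ?_
    rcases S.eq_empty_or_nonempty with rfl | hS
    · simp [collIndicator, collCount_empty]
    · simp [stateAfter, component_const S hS]
  simp [collAmplitude, h]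

theorem collAmplitude_succ_succ_le (A : QuantumQueryAlgorithm X Y Z O) (k j i : ℕ) :
    A.collAmplitude k (j + 1) (i + 1) ≤ A.collAmplitude k j i := by
  refine A.collAmplitude_le_of_le ?_
  simp only [stateAfter]
  rw [componentMass_isometry]
  exact componentMass_query_succ_le k j _

/-- Each query adds at most one collision. For `k = 1` this says that `i` queries record at most `i`
inputs, the base of the chain of thresholds. -/
theorem collAmplitude_eq_zero (A : QuantumQueryAlgorithm X Y Z O) (k : ℕ) {i j : ℕ} (h : i < j) :
    A.collAmplitude k j i = 0 := by
  induction i generalizing j with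
  | zero =>
    obtain ⟨j, rfl⟩ := Nat.exists_eq_succ_of_ne_zero h.ne'
    exact A.collAmplitude_succ_zero k j
  | succ i ih =>
    obtain ⟨j, rfl⟩ := Nat.exists_eq_succ_of_ne_zero (Nat.ne_zero_of_lt h)
    exact le_antisymm ((A.collAmplitude_succ_succ_le k j i).trans (ih (by omega)).le)
      (Real.sqrt_nonneg _)

theorem collAmplitude_succ_le (A : QuantumQueryAlgorithm X Y Z O) {k : ℕ} (hk : 1 ≤ k)
    (j M i : ℕ) :
    A.collAmplitude (k + 1) (j + 1) (i + 1) ≤ A.collAmplitude (k + 1) (j + 1) i +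
      2 * √(M / Fintype.card Y) * A.collAmplitude (k + 1) j i + A.collAmplitude k (M + 1) i := by
  set ψ : (X → Y) → RegisterSpace X Y Z := fun f => A.stateAfter f i with hψ
  set n : ℝ := (Fintype.card (X → Y) : ℝ) with hn
  have hn0 : 0 < n := Nat.cast_pos.mpr Fintype.card_pos
  have hnn : ∀ k j, 0 ≤ componentMass (collIndicator k j) ψ / n := fun k j =>
    div_nonneg (componentMass_nonneg (collIndicator_nonneg k j) ψ) hn0.le
  have h1 : A.collAmplitude (k + 1) (j + 1) (i + 1) =
      √(componentMass (collIndicator (k + 1) (j + 1)) (fun f => queryOracle Z f (ψ f)) / n) := by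
    simp only [collAmplitude, stateAfter]
    rw [componentMass_isometry]
  have h2 := sqrt_le_sqrt_add_sqrt_of_forall
    (A' := componentMass (collIndicator (k + 1) (j + 1)) (fun f => queryOracle Z f (ψ f)) / n)
    (A := componentMass (collIndicator (k + 1) (j + 1)) ψ / n)
    (B := 4 * (M / Fintype.card Y) * (componentMass (collIndicator (k + 1) j) ψ / n) +
      componentMass (collIndicator k (M + 1)) ψ / n) (hnn _ _)
    (add_nonneg (mul_nonneg (by positivity) (hnn _ _)) (hnn _ _))
    (fun δ hδ => by
      have h := div_le_div_of_nonneg_right (componentMass_query_le hk j M ψ hδ) hn0.le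
      refine h.trans (le_of_eq ?_)
      field_simp)
  rw [h1]
  refine h2.trans ?_
  rw [add_assoc]
  refine add_le_add_right ((sqrt_add_le_sqrt_add_sqrt (mul_nonneg (by positivity) (hnn _ _))
    (hnn _ _)).trans ?_) _
  refine add_le_add_left (le_of_eq ?_) _
  rw [Real.sqrt_mul (by positivity), Real.sqrt_mul (by norm_num),
    show (4 : ℝ) = 2 ^ 2 by norm_num, Real.sqrt_sq (by norm_num)]
  rfl

theorem collAmplitude_le_exp (A : QuantumQueryAlgorithm X Y Z O) {k : ℕ} (hk : 1 ≤ k) (M q : ℕ)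
    {ε t L : ℝ} (hε : ∀ i ≤ q, A.collAmplitude k (M + 1) i ≤ ε) (ht : 0 < t)
    (hL : q * (2 * √(M / Fintype.card Y)) ≤ L) {i : ℕ} (hi : i ≤ q) (j : ℕ) :
    A.collAmplitude (k + 1) j i ≤ Real.exp (L / t) * t ^ j + q * Real.exp L * ε := by
  have hε0 : 0 ≤ ε := (Real.sqrt_nonneg _).trans (hε 0 (Nat.zero_le q))
  refine le_of_add_recurrence (fun i j => A.collAmplitude (k + 1) j i) q (by positivity) hε0 ht hL
    (fun i => A.collAmplitude_le_one _ _ _) (fun j => (A.collAmplitude_succ_zero _ _).le)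
    (fun i j hi => ?_) hi j
  have h1 := A.collAmplitude_succ_le hk j M i
  have h2 := hε i hi.le
  linarith

theorem sqrt_successProb_le (A : QuantumQueryAlgorithm X Y Z (Finset (Finset X))) {k : ℕ}
    (hk : 2 ≤ k) (j : ℕ) :
    √(A.successProb fun f C => IsCollisionFamily k j f C) ≤
      A.collAmplitude k j A.queries + (k * j : ℕ) / √(Fintype.card Y) := by
  set ψ : (X → Y) → RegisterSpace X Y Z := fun f => A.stateAfter f A.queries with hψ
  set n : ℝ := (Fintype.card (X → Y) : ℝ) with hn
  have hn0 : 0 < n := Nat.cast_pos.mpr Fintype.card_pos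
  have hsum : ∑ f, ‖ψ f‖ ^ 2 = n := by simp [hψ, hn, norm_stateAfter]
  have h2 := sqrt_le_sqrt_add_sqrt_of_forall
    (A' := A.successProb fun f C => IsCollisionFamily k j f C)
    (A := componentMass (collIndicator k j) ψ / n)
    (B := ((k * j : ℕ) : ℝ) ^ 2 / Fintype.card Y)
    (div_nonneg (componentMass_nonneg (collIndicator_nonneg k j) ψ) hn0.le) (by positivity)
    (fun δ hδ => by
      have h := div_le_div_of_nonneg_right
        (sum_sum_sq_isCollisionFamily_le hk j A.output ψ hδ) hn0.le
      rw [hsum] at h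
      unfold successProb probOutput
      refine h.trans (le_of_eq ?_)
      field_simp)
  rw [Real.sqrt_div (sq_nonneg _), Real.sqrt_sq (Nat.cast_nonneg _)] at h2
  exact h2

end Amplitude

end QuantumQueryAlgorithm

/-! ### Chaining the levels from 1- to 4-collisions -/

namespace QuantumQueryAlgorithm

/-- The square roots in `L = 2q√(M/N)` are nested three deep; with eighth powers for `q` and `N`
they all become integer powers of `r` and `n`. The thresholds are `q`, `8 * L₂`, `8 * L₃`. -/
theorem sqrt_successProb_le_exp {X Y Z : Type*} [Fintype X] [DecidableEq X] [Fintype Y]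
    [AddCommGroup Y] [Fintype Z] (A : QuantumQueryAlgorithm X Y Z (Finset (Finset X))) (j : ℕ)
    {r n t : ℝ} (hr : 0 ≤ r) (hn : 0 < n) (ht : 0 < t) (hN : (Fintype.card Y : ℝ) = n ^ 8)
    (hq : (A.queries : ℝ) ≤ r ^ 8) :
    √(A.successProb fun f C => IsCollisionFamily 4 j f C) ≤
      Real.exp (16 * r ^ 15 / n ^ 7 / t) * t ^ j +
      r ^ 8 * Real.exp (16 * r ^ 15 / n ^ 7) * (Real.exp (-5 * (8 * r ^ 14 / n ^ 6)) +
        r ^ 8 * Real.exp (8 * r ^ 14 / n ^ 6 - 5 * (2 * r ^ 12 / n ^ 4))) +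
      4 * j / n ^ 4 := by
  classical
  set q := A.queries with hqdef
  set L₂ := 2 * r ^ 12 / n ^ 4 with hL₂
  set L₃ := 8 * r ^ 14 / n ^ 6 with hL₃
  set L₄ := 16 * r ^ 15 / n ^ 7 with hL₄
  have hL₂0 : 0 ≤ L₂ := by positivity
  have hL₃0 : 0 ≤ L₃ := by positivity
  have hsqrt : ∀ {M : ℕ} {K s L : ℝ}, (M : ℝ) ≤ K → 0 ≤ s → K = s ^ 2 * n ^ 8 →
      r ^ 8 * (2 * s) = L → q * (2 * √((M : ℝ) / Fintype.card Y)) ≤ L := by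
    intro M K s L hM hs hK hL
    rw [← hL]
    have h : √((M : ℝ) / Fintype.card Y) ≤ s := by
      rw [Real.sqrt_le_left hs, hN, div_le_iff₀ (by positivity), ← hK]
      exact hM
    gcongr
  -- a threshold of eight times the exponent makes the tail small
  have htail : ∀ {L : ℝ}, 0 ≤ L → Real.exp (L / Real.exp (-1)) * Real.exp (-1) ^ (⌊8 * L⌋₊ + 1) ≤
      Real.exp (-5 * L) := by
    intro L hL
    rw [← Real.exp_nat_mul, ← Real.exp_add, Real.exp_le_exp, Real.exp_neg, div_inv_eq_mul]
    have h1 : 8 * L < (⌊8 * L⌋₊ : ℝ) + 1 := Nat.lt_floor_add_one _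
    have h2 := mul_le_mul_of_nonneg_left (Real.exp_one_lt_d9.le) hL
    push_cast
    linarith
  have h₂ : ∀ i ≤ q, A.collAmplitude 2 (⌊8 * L₂⌋₊ + 1) i ≤ Real.exp (-5 * L₂) := by
    intro i hi
    -- At the bottom level the error is exactly zero: at most `q` inputs are recorded.
    have h := A.collAmplitude_le_exp (k := 1) le_rfl q q (ε := 0) (t := Real.exp (-1)) (L := L₂)
      (fun i hi => (A.collAmplitude_eq_zero 1 (Nat.lt_succ_of_le hi)).le) (Real.exp_pos _)
      (hsqrt hq (s := r ^ 4 / n ^ 4) (by positivity) (by field_simp) (by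
        rw [hL₂]
        ring)) hi
      (⌊8 * L₂⌋₊ + 1)
    rw [mul_zero, add_zero] at h
    exact h.trans (htail hL₂0)
  have h₃ : ∀ i ≤ q, A.collAmplitude 3 (⌊8 * L₃⌋₊ + 1) i ≤
      Real.exp (-5 * L₃) + r ^ 8 * Real.exp (L₃ - 5 * L₂) := by
    intro i hi
    have h := A.collAmplitude_le_exp (k := 2) (by norm_num) ⌊8 * L₂⌋₊ q (t := Real.exp (-1))
      (L := L₃) h₂ (Real.exp_pos _)
      (hsqrt (Nat.floor_le (by positivity)) (s := 4 * r ^ 6 / n ^ 6) (by positivity) (by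
        rw [hL₂]
        field_simp
        ring) (by
        rw [hL₃]
        ring)) hi
      (⌊8 * L₃⌋₊ + 1)
    refine h.trans (add_le_add (htail hL₃0) ?_)
    rw [mul_assoc, ← Real.exp_add, show L₃ + -5 * L₂ = L₃ - 5 * L₂ by ring]
    gcongr
  have h₄ := A.collAmplitude_le_exp (k := 3) (by norm_num) ⌊8 * L₃⌋₊ q (t := t)
    (L := L₄) h₃ ht
    (hsqrt (Nat.floor_le (by positivity)) (s := 8 * r ^ 7 / n ^ 7) (by positivity) (by
      rw [hL₃]
      field_simp) (by
      rw [hL₄]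
      ring)) le_rfl j
  refine (A.sqrt_successProb_le (k := 4) (by norm_num) j).trans (add_le_add (h₄.trans ?_) ?_)
  · gcongr
  · rw [hN, show n ^ 8 = (n ^ 4) ^ 2 by ring, Real.sqrt_sq (by positivity)]
    push_cast
    exact le_rfl

end QuantumQueryAlgorithm

/-! ### Choice of parameters -/

theorem exists_forall_pow_mul_exp_neg_lt {ε : ℝ} (hε : 0 < ε) :
    ∃ x₀ : ℝ, ∀ x, x₀ ≤ x →
      x ^ 120 * Real.exp (-x) + x ^ 240 * Real.exp (-x) + 4 * x⁻¹ < ε := by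
  have h := ((Real.tendsto_pow_mul_exp_neg_atTop_nhds_zero 120).add
    (Real.tendsto_pow_mul_exp_neg_atTop_nhds_zero 240)).add
    (tendsto_inv_atTop_zero.const_mul (4 : ℝ))
  have h2 := h.eventually (gt_mem_nhds (by simpa using hε))
  exact Filter.eventually_atTop.mp h2

/-- With `t = 16γ^15` the exponent `L₄ / t` is exactly `j`, so the main term is `(e·t)^j ≤ δ`. The
errors vanish because each scale dominates the next: `ι ≤ x`, the form of `j ≤ N^(1/16)`, gives `L₄
≤ L₃ / 8`, and `L₃ / 8 ≤ x^30 ≤ L₂ / 2`. -/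
theorem sqrt_lt_of_exp_bound {P γ ι x δ ε : ℝ} {j : ℕ} (hγ : 0 < γ) (hγ1 : γ ≤ 1) (hι : 1 ≤ ι)
    (hιx : ι ≤ x) (hx : γ⁻¹ ^ 14 ≤ x) (hj : (j : ℝ) = ι ^ 15)
    (hδ1 : δ ≤ 1) (hδ : Real.exp 1 * (16 * γ ^ 15) ≤ δ)
    (hε : x ^ 120 * Real.exp (-x) + x ^ 240 * Real.exp (-x) + 4 * x⁻¹ < ε)
    (hP : P ≤ Real.exp (16 * (γ * ι * x ^ 14) ^ 15 / (x ^ 30) ^ 7 / (16 * γ ^ 15)) *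
        (16 * γ ^ 15) ^ j +
      (γ * ι * x ^ 14) ^ 8 * Real.exp (16 * (γ * ι * x ^ 14) ^ 15 / (x ^ 30) ^ 7) *
        (Real.exp (-5 * (8 * (γ * ι * x ^ 14) ^ 14 / (x ^ 30) ^ 6)) +
          (γ * ι * x ^ 14) ^ 8 * Real.exp (8 * (γ * ι * x ^ 14) ^ 14 / (x ^ 30) ^ 6 -
            5 * (2 * (γ * ι * x ^ 14) ^ 12 / (x ^ 30) ^ 4))) +
      4 * j / (x ^ 30) ^ 4) : P < δ + ε := by
  have hx1 : 1 ≤ x := hι.trans hιx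
  have hx0 : 0 < x := by linarith
  have hι0 : 0 < ι := by linarith
  have e1 : 16 * (γ * ι * x ^ 14) ^ 15 / (x ^ 30) ^ 7 = 16 * γ ^ 15 * ι ^ 15 := by
    field_simp
  have e2 : 8 * (γ * ι * x ^ 14) ^ 14 / (x ^ 30) ^ 6 = 8 * (γ ^ 14 * ι ^ 14 * x ^ 16) := by
    field_simp
  have e3 : 2 * (γ * ι * x ^ 14) ^ 12 / (x ^ 30) ^ 4 = 2 * (γ ^ 12 * ι ^ 12 * x ^ 48) := by
    field_simp
  rw [e1, e2, e3] at hP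
  have hjpos : j ≠ 0 := by
    rintro rfl
    have : 0 < ι ^ 15 := by positivity
    rw [← hj] at this
    simp at this
  have hmain : Real.exp (16 * γ ^ 15 * ι ^ 15 / (16 * γ ^ 15)) * (16 * γ ^ 15) ^ j ≤ δ := by
    rw [mul_div_cancel_left₀ _ (by positivity), ← hj]
    have h1 : Real.exp j = Real.exp 1 ^ j := by rw [← Real.exp_nat_mul, mul_one]
    rw [h1, ← mul_pow]
    exact (pow_le_of_le_one (by positivity) (hδ.trans hδ1) hjpos).trans hδ
  have hR : (γ * ι * x ^ 14) ^ 8 ≤ x ^ 120 := by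
    calc (γ * ι * x ^ 14) ^ 8 ≤ (1 * x * x ^ 14) ^ 8 := by gcongr
      _ = x ^ 120 := by ring
  have hγx : 1 ≤ γ ^ 14 * x := by
    have h1 := mul_le_mul_of_nonneg_left hx (by positivity : 0 ≤ γ ^ 14)
    rwa [← mul_pow, mul_inv_cancel₀ hγ.ne', one_pow] at h1
  have hs : 16 * γ ^ 15 ≤ 1 := by
    have h1 : 1 ≤ Real.exp 1 := Real.one_le_exp (by norm_num)
    have h2 : 0 ≤ 16 * γ ^ 15 := by positivity
    nlinarith
  have hL4 : 16 * γ ^ 15 * ι ^ 15 ≤ x ^ 15 := by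
    calc 16 * γ ^ 15 * ι ^ 15 ≤ 1 * x ^ 15 := by gcongr
      _ = x ^ 15 := one_mul _
  have hL3 : x ^ 15 ≤ γ ^ 14 * ι ^ 14 * x ^ 16 := by
    calc x ^ 15 = 1 * 1 * x ^ 15 := by ring
      _ ≤ (γ ^ 14 * x) * ι ^ 14 * x ^ 15 := by
        gcongr
        exact one_le_pow₀ hι
      _ = γ ^ 14 * ι ^ 14 * x ^ 16 := by ring
  have hL3' : γ ^ 14 * ι ^ 14 * x ^ 16 ≤ x ^ 30 := by
    calc γ ^ 14 * ι ^ 14 * x ^ 16 ≤ 1 * x ^ 14 * x ^ 16 := by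
          gcongr
          exact pow_le_one₀ hγ.le hγ1
      _ = x ^ 30 := by ring
  have hL2 : x ^ 30 ≤ γ ^ 12 * ι ^ 12 * x ^ 48 := by
    have h1 : γ ^ 14 * x ≤ γ ^ 12 * x ^ 18 := by
      have h2 : γ ^ 14 ≤ γ ^ 12 := pow_le_pow_of_le_one hγ.le hγ1 (by norm_num)
      have h3 : x ≤ x ^ 18 := le_self_pow₀ hx1 (by norm_num)
      gcongr
    calc x ^ 30 = 1 * 1 * x ^ 30 := by ring
      _ ≤ (γ ^ 12 * x ^ 18) * ι ^ 12 * x ^ 30 := by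
        gcongr
        · exact hγx.trans h1
        · exact one_le_pow₀ hι
      _ = γ ^ 12 * ι ^ 12 * x ^ 48 := by ring
  have hx15 : x ≤ x ^ 15 := le_self_pow₀ hx1 (by norm_num)
  have hx30 : x ^ 15 ≤ x ^ 30 := pow_le_pow_right₀ hx1 (by norm_num)
  have herr : (γ * ι * x ^ 14) ^ 8 * Real.exp (16 * γ ^ 15 * ι ^ 15) *
        (Real.exp (-5 * (8 * (γ ^ 14 * ι ^ 14 * x ^ 16))) +
          (γ * ι * x ^ 14) ^ 8 * Real.exp (8 * (γ ^ 14 * ι ^ 14 * x ^ 16) -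
            5 * (2 * (γ ^ 12 * ι ^ 12 * x ^ 48)))) ≤
      x ^ 120 * Real.exp (-x) + x ^ 240 * Real.exp (-x) := by
    rw [mul_add, mul_assoc, ← Real.exp_add]
    refine add_le_add ?_ ?_
    · gcongr
      linarith
    · calc _ = ((γ * ι * x ^ 14) ^ 8 * (γ * ι * x ^ 14) ^ 8) *
            Real.exp (16 * γ ^ 15 * ι ^ 15 + (8 * (γ ^ 14 * ι ^ 14 * x ^ 16) -
            5 * (2 * (γ ^ 12 * ι ^ 12 * x ^ 48)))) := by
            rw [Real.exp_add]
            ring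
        _ ≤ (x ^ 120 * x ^ 120) * Real.exp (-x) := by
            gcongr
            linarith
        _ = x ^ 240 * Real.exp (-x) := by ring
  have hlast : 4 * (j : ℝ) / (x ^ 30) ^ 4 ≤ 4 * x⁻¹ := by
    rw [hj, div_le_iff₀ (by positivity)]
    calc 4 * ι ^ 15 ≤ 4 * x ^ 15 := by gcongr
      _ ≤ 4 * x ^ 119 := by
        gcongr
        norm_num
      _ = 4 * x⁻¹ * (x ^ 30) ^ 4 := by
        field_simp
  linarith

theorem mainTheorem6 (p : ℝ) (hp : 0 < p) :
    ∃ c : ℝ, 0 < c ∧ ∃ N₀ : ℕ, ∀ N j : ℕ, N₀ ≤ N → (j : ℝ) ≤ (N : ℝ) ^ (1 / 16 : ℝ) →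
      ∀ (X Y Z : Type*) [Fintype X] [DecidableEq X] [Fintype Y] [AddCommGroup Y] [Fintype Z],
        Fintype.card Y = N →
        ∀ A : QuantumQueryAlgorithm X Y Z (Finset (Finset X)),
          p ≤ A.successProb (fun f C => IsCollisionFamily 4 j f C) →
          c * (j : ℝ) ^ (8 / 15 : ℝ) * (N : ℝ) ^ (7 / 15 : ℝ) ≤ (A.queries : ℝ) := by
  have hsp : 0 < √p := Real.sqrt_pos.mpr hp
  set δ : ℝ := min 1 (√p / 2) with hδ
  have hδ0 : 0 < δ := lt_min one_pos (by positivity)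
  have hδ1 : δ ≤ 1 := min_le_left _ _
  have hδp : δ ≤ √p / 2 := min_le_right _ _
  -- Here `48 = 3 · 16`, from `e < 3` and `16γ^15 ≤ 16γ`.
  set γ : ℝ := δ / 48 with hγ
  have hγ0 : 0 < γ := by positivity
  have hγ1 : γ ≤ 1 := by linarith
  have hγδ : Real.exp 1 * (16 * γ ^ 15) ≤ δ := by
    have h1 : γ ^ 15 ≤ γ := pow_le_of_le_one hγ0.le hγ1 (by norm_num)
    have h2 := Real.exp_one_lt_three.le
    calc Real.exp 1 * (16 * γ ^ 15) ≤ 3 * (16 * γ) := by gcongr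
      _ = δ := by rw [hγ]; ring
  obtain ⟨x₀, hx₀⟩ := exists_forall_pow_mul_exp_neg_lt (half_pos hsp)
  set x₁ : ℝ := max 1 (max x₀ (γ⁻¹ ^ 14)) with hx₁
  have hx₁1 : 1 ≤ x₁ := le_max_left _ _
  refine ⟨γ ^ 8, by positivity, ⌈x₁ ^ 240⌉₊, fun N j hN hj X Y Z _ _ _ _ _ hY A hA => ?_⟩
  -- As `240 = 15 · 16`, both `N^(7/15)` and `N^(1/16)` are integer powers of `x`.
  set x : ℝ := (N : ℝ) ^ (1 / 240 : ℝ) with hx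
  set ι : ℝ := (j : ℝ) ^ (1 / 15 : ℝ) with hι
  have hN0 : (0 : ℝ) ≤ N := Nat.cast_nonneg N
  have hj0 : (0 : ℝ) ≤ j := Nat.cast_nonneg j
  have hxpow : ∀ k : ℕ, x ^ k = (N : ℝ) ^ ((k : ℝ) / 240) := by
    intro k
    rw [hx, ← Real.rpow_mul_natCast hN0]
    congr 1
    ring
  have hιpow : ∀ k : ℕ, ι ^ k = (j : ℝ) ^ ((k : ℝ) / 15) := by
    intro k
    rw [hι, ← Real.rpow_mul_natCast hj0]
    congr 1
    ring
  have hx240 : x ^ 240 = N := by rw [hxpow]; norm_num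
  have hι15 : ι ^ 15 = j := by rw [hιpow]; norm_num
  have hx112 : x ^ 112 = (N : ℝ) ^ (7 / 15 : ℝ) := by rw [hxpow]; norm_num
  have hx15 : x ^ 15 = (N : ℝ) ^ (1 / 16 : ℝ) := by rw [hxpow]; norm_num
  have hι8 : ι ^ 8 = (j : ℝ) ^ (8 / 15 : ℝ) := by rw [hιpow]; norm_num
  rcases Nat.eq_zero_or_pos j with h0 | hjpos
  · subst h0
    simp
  have hxx₁ : x₁ ≤ x := by
    refine le_of_pow_le_pow_left₀ (n := 240) (by norm_num) (by positivity) ?_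
    rw [hx240]
    exact (Nat.le_ceil _).trans (Nat.cast_le.mpr hN)
  have hx0 : 0 < x := by linarith
  have hι1 : 1 ≤ ι := Real.one_le_rpow (by exact_mod_cast hjpos) (by norm_num)
  have hιx : ι ≤ x := by
    refine le_of_pow_le_pow_left₀ (n := 15) (by norm_num) hx0.le ?_
    rw [hι15, hx15]
    exact hj
  rw [← hι8, ← hx112]
  by_contra hcon
  have hq : (A.queries : ℝ) ≤ (γ * ι * x ^ 14) ^ 8 := by
    have h1 : (γ * ι * x ^ 14) ^ 8 = γ ^ 8 * ι ^ 8 * x ^ 112 := by ring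
    rw [h1]
    exact (not_le.mp hcon).le
  have hbound := A.sqrt_successProb_le_exp j (r := γ * ι * x ^ 14) (n := x ^ 30)
    (t := 16 * γ ^ 15) (by positivity) (by positivity) (by positivity)
    (by rw [hY, ← hx240]; ring) hq
  have hlt := sqrt_lt_of_exp_bound hγ0 hγ1 hι1 hιx
    ((le_max_right _ _).trans ((le_max_right _ _).trans hxx₁)) hι15.symm hδ1 hγδ
    (hx₀ x ((le_max_left _ _).trans ((le_max_right _ _).trans hxx₁))) hbound
  have hle := Real.sqrt_le_sqrt hA
  linarith
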